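/- Let $N\ge 2$ and equip $\mathbb{R}^N$ with the Euclidean norm. A convex body is a compact convex subset of $\mathbb{R}^N$ with nonempty interior. For $f:\mathbb{R}^N\to\mathbb{R}$ and $x\in\mathbb{R}^N$ let $$\partial f(x)=\mathrm{conv}\Bigl\{\lim_{n\to\infty}\nabla f(x_n)\;:\; x_n\to x,\ f\text{ differentiable at each }x_n\Bigr\}$$ be the Clarke subdifferential (only sequences for which the limit exists are considered). Let $\widehat\partial f(x)$ be the set of all $\nabla\varphi(x)$, where $\varphi:\mathbb{R}^N\to\mathbb{R}$ is $C^1$-smooth, $\varphi\le f$ and $\varphi(x)=f(x)$, and let the limiting subdifferential be $$\partial_L f(x)=\Bigl\{\lim_{n\to\infty} x_n^*\;:\; x_n\to x,\ x_n^*\in\widehat\partial f(x_n)\Bigr\}.$$ (1) There is an everywhere differentiable, $1$-Lipschitz, compactly supported function $f:\mathbb{R}^N\to\mathbb{R}$ such that $\partial f(x)=\partial_L f(x)$ for every $x\in\mathbb{R}^N$, and for every convex body $K\subset\overline{B}(0,1)$ there is $x\in\mathbb{R}^N$ with $\partial f(x)=\partial_L f(x)=K$. (2) There are functions $f_n:\mathbb{R}^N\to\mathbb{R}$,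 $n\ge 1$, with pairwise disjoint supports, such that each $f_n$ is differentiable, $n$-Lipschitz and compactly supported, and for every convex body $K\subset\overline{B}(0,n)$ there is $x\in\mathbb{R}^N$ with $\partial f_n(x)=\partial_L f_n(x)=K$; moreover the sum $g=\sum_{n\ge1}f_n$ is differentiable and locally Lipschitz on $\mathbb{R}^N$, and for every convex body $K\subset\mathbb{R}^N$ there is $x\in\mathbb{R}^N$ with $\partial g(x)=\partial_L g(x)=K$. -/

import Mathlib

open Filter Topology

/-- The Clarke subdifferential of `f` at `x`: the convex hull of all limits of gradients
`∇f(x_n)` along sequences `x_n → x` of points of differentiability of `f`. -/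
noncomputable def clarkeSubdiff {N : ℕ} (f : EuclideanSpace ℝ (Fin N) → ℝ)
    (x : EuclideanSpace ℝ (Fin N)) : Set (EuclideanSpace ℝ (Fin N)) :=
  convexHull ℝ {p | ∃ u : ℕ → EuclideanSpace ℝ (Fin N),
    (∀ n, DifferentiableAt ℝ f (u n)) ∧ Tendsto u atTop (𝓝 x) ∧
      Tendsto (fun n => gradient f (u n)) atTop (𝓝 p)}

/-- The set of Fréchet subgradients of `f` at `x`: the gradients at `x` of the `C¹`-smooth
functions `φ ≤ f` with `φ(x) = f(x)`. -/
def frechetSubdiff {N : ℕ} (f : EuclideanSpace ℝ (Fin N) → ℝ)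
    (x : EuclideanSpace ℝ (Fin N)) : Set (EuclideanSpace ℝ (Fin N)) :=
  {p | ∃ φ : EuclideanSpace ℝ (Fin N) → ℝ,
    ContDiff ℝ 1 φ ∧ (∀ y, φ y ≤ f y) ∧ φ x = f x ∧ gradient φ x = p}

/-- The limiting subdifferential of `f` at `x`: all limits of Fréchet subgradients of `f` at
points converging to `x`. -/
def limitingSubdiff {N : ℕ} (f : EuclideanSpace ℝ (Fin N) → ℝ)
    (x : EuclideanSpace ℝ (Fin N)) : Set (EuclideanSpace ℝ (Fin N)) :=
  {p | ∃ u v : ℕ → EuclideanSpace ℝ (Fin N),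
    (∀ n, v n ∈ frechetSubdiff f (u n)) ∧ Tendsto u atTop (𝓝 x) ∧
      Tendsto v atTop (𝓝 p)}

/-- A convex body: a compact convex set with nonempty interior. -/
def IsConvexBody {N : ℕ} (K : Set (EuclideanSpace ℝ (Fin N))) : Prop :=
  IsCompact K ∧ Convex ℝ K ∧ (interior K).Nonempty

/-! For a differentiable `f`, let `gradientCluster f x` be the set of limits of gradients at points
tending to `x`. The Clarke subdifferential is its convex hull. If moreover `f ≥ 0` has a local `C¹`
minorant touching it at every point, the limiting subdifferential is `gradientCluster f x` itself.
It suffices to build nonnegative functions with such minorants, with all clusters convex and every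
convex body occurring as a cluster.

The basic brick is a tiny `C¹` bump whose gradients stay in a given convex body around `0` and
almost fill it: a mollified cone (`exists_bump_gradient_dense`). Bumps are stacked at heights `2⁻ᵏ`
over a hyperplane with sizes of order `4⁻ᵏ`. The sum is then quadratically small near the
hyperplane, hence differentiable there with gradient `0`, while gradients of nearby bumps may
accumulate at points of the hyperplane to large sets (`IsBumpStack`).

Fix `p` with `‖p‖ < 1`. The compact convex sets in the unit ball through `p` form a continuous image
of the Cantor set (`exists_cantor_family`). Place that Cantor set on a line in the hyperplane, and
above a dense sequence of its points put bumps which, added to a function of gradient `p`, have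
gradients filling the corresponding sets. By continuity of the family, the cluster at the point `a`
is exactly `Ψ a` (`exists_realizing_function`).

A convex body has interior, so it contains a point of any dense sequence of values `p`. Stacking
shrunken copies of the functions for these `p` along a sequence tending to `0` realizes all bodies
in the unit ball; at `0` the cluster is the whole closed ball, still convex
(`exists_universal_function`). Part (2) uses separated copies with gradients scaled by `n + 1`. -/

open scoped Pointwise

/-! ### Mollification by averaging over small balls. -/

section Mollification

variable {V : Type*} [NormedAddCommGroup V] [InnerProductSpace ℝ V] [FiniteDimensional ℝ V]

/-- Averaging over a ball of radius `η` produces a `C¹` function which inherits bounds for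
increments and values. -/
theorem exists_contDiff_average {b : V → ℝ} (hb : Continuous b) {η : ℝ} (hη : 0 < η) :
    ∃ g : V → ℝ, ContDiff ℝ 1 g ∧
      (∀ x y m, (∀ t, ‖t‖ ≤ η → b (x - t) - b (y - t) ≤ m) → g x - g y ≤ m) ∧
      (∀ x m, (∀ t, ‖t‖ ≤ η → b (x - t) ≤ m) → g x ≤ m) ∧
      (∀ x m, (∀ t, ‖t‖ ≤ η → m ≤ b (x - t)) → m ≤ g x) := by
  let _ : MeasurableSpace V := borel V
  have _ : BorelSpace V := ⟨rfl⟩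
  let μ : MeasureTheory.Measure V := MeasureTheory.Measure.addHaar
  let φ : ContDiffBump (0 : V) := ⟨η / 2, η, by linarith, by linarith⟩
  let w := φ.normed μ
  have hw0 : ∀ t, 0 ≤ w t := fun t => φ.nonneg_normed t
  have hwout : ∀ t, ¬ ‖t‖ ≤ η → w t = 0 := by
    intro t ht
    by_contra h
    have : t ∈ Function.support (φ.normed μ) := h
    rw [φ.support_normed_eq, Metric.mem_ball, dist_zero_right] at this
    exact ht this.le
  have hwc : Continuous w := φ.continuous_normed
  have hwi : MeasureTheory.Integrable w μ := φ.integrable_normed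
  have hw1 : ∫ t, w t ∂μ = 1 := φ.integral_normed
  have hint : ∀ x, MeasureTheory.Integrable (fun t => w t * b (x - t)) μ := fun x =>
    (hwc.mul (hb.comp (continuous_const.sub continuous_id))).integrable_of_hasCompactSupport
      (φ.hasCompactSupport_normed.mul_right)
  have hcm : ∀ m : ℝ, ∫ t, w t * m ∂μ = m := fun m => by
    rw [MeasureTheory.integral_mul_const, hw1, one_mul]
  refine ⟨fun x => ∫ t, w t * b (x - t) ∂μ, ?_, ?_, ?_, ?_⟩
  · have := HasCompactSupport.contDiff_convolution_left (μ := μ) (n := 1)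
      (ContinuousLinearMap.lsmul ℝ ℝ) (φ.hasCompactSupport_normed (μ := μ))
      (by exact_mod_cast φ.contDiff_normed (n := 1)) hb.locallyIntegrable
    exact this
  · intro x y m h
    change ∫ t, w t * b (x - t) ∂μ - ∫ t, w t * b (y - t) ∂μ ≤ m
    rw [← MeasureTheory.integral_sub (hint x) (hint y), ← hcm m]
    refine MeasureTheory.integral_mono ((hint x).sub (hint y)) (hwi.mul_const m) fun t => ?_
    by_cases ht : ‖t‖ ≤ η
    · have := mul_le_mul_of_nonneg_left (h t ht) (hw0 t)
      linarith
    · simp [hwout t ht]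
  · intro x m h
    change ∫ t, w t * b (x - t) ∂μ ≤ m
    rw [← hcm m]
    refine MeasureTheory.integral_mono (hint x) (hwi.mul_const m) fun t => ?_
    by_cases ht : ‖t‖ ≤ η
    · exact mul_le_mul_of_nonneg_left (h t ht) (hw0 t)
    · simp [hwout t ht]
  · intro x m h
    change m ≤ ∫ t, w t * b (x - t) ∂μ
    rw [← hcm m]
    refine MeasureTheory.integral_mono (hwi.mul_const m) (hint x) fun t => ?_
    by_cases ht : ‖t‖ ≤ η
    · exact mul_le_mul_of_nonneg_left (h t ht) (hw0 t)
    · simp [hwout t ht]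

end Mollification

/-! ### Support functions and bumps with prescribed gradient range. -/

section SupportFunction

variable {V : Type*} [NormedAddCommGroup V] [InnerProductSpace ℝ V]

/-- The support function of a set. -/
noncomputable def supportFun (C : Set V) (v : V) : ℝ := sSup ((fun q => inner ℝ q v) '' C)

theorem inner_le_supportFun {C : Set V} {B : ℝ} (hB : ∀ q ∈ C, ‖q‖ ≤ B) {q : V} (hq : q ∈ C)
    (v : V) : inner ℝ q v ≤ supportFun C v := by
  refine le_csSup ⟨B * ‖v‖, ?_⟩ ⟨q, hq, rfl⟩
  rintro _ ⟨q, hq, rfl⟩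
  exact (real_inner_le_norm q v).trans (mul_le_mul_of_nonneg_right (hB q hq) (norm_nonneg v))

theorem supportFun_le {C : Set V} (hC : C.Nonempty) {v : V} {m : ℝ}
    (h : ∀ q ∈ C, inner ℝ q v ≤ m) : supportFun C v ≤ m := by
  refine csSup_le (hC.image _) ?_
  rintro _ ⟨q, hq, rfl⟩
  exact h q hq

theorem supportFun_add_le {C : Set V} {B : ℝ} (hC : C.Nonempty) (hB : ∀ q ∈ C, ‖q‖ ≤ B)
    (v w : V) : supportFun C (v + w) ≤ supportFun C v + supportFun C w := by
  refine supportFun_le hC fun q hq => ?_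
  rw [inner_add_right]
  exact add_le_add (inner_le_supportFun hB hq v) (inner_le_supportFun hB hq w)

theorem supportFun_le_mul_norm {C : Set V} {B : ℝ} (hC : C.Nonempty) (hB : ∀ q ∈ C, ‖q‖ ≤ B)
    (v : V) : supportFun C v ≤ B * ‖v‖ :=
  supportFun_le hC fun q hq =>
    (real_inner_le_norm q v).trans (mul_le_mul_of_nonneg_right (hB q hq) (norm_nonneg v))

theorem mul_norm_le_supportFun {C : Set V} {B r : ℝ} (hB : ∀ q ∈ C, ‖q‖ ≤ B) (hr : 0 < r)
    (hrC : Metric.closedBall 0 r ⊆ C) (v : V) : r * ‖v‖ ≤ supportFun C v := by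
  rcases eq_or_ne v 0 with rfl | hv
  · have h0 : (0 : V) ∈ C := hrC (by simp [hr.le])
    simpa using inner_le_supportFun hB h0 (0 : V)
  · have hv' : ‖v‖ ≠ 0 := norm_ne_zero_iff.2 hv
    have hq : (r / ‖v‖) • v ∈ C := hrC (by
      rw [mem_closedBall_zero_iff, norm_smul, Real.norm_of_nonneg (by positivity)]
      exact (div_mul_cancel₀ r hv').le)
    have := inner_le_supportFun hB hq v
    rw [real_inner_smul_left, real_inner_self_eq_norm_sq] at this
    calc r * ‖v‖ = r / ‖v‖ * ‖v‖ ^ 2 := by field_simp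
      _ ≤ _ := this

theorem continuous_supportFun {C : Set V} {B : ℝ} (hC : C.Nonempty) (hB : ∀ q ∈ C, ‖q‖ ≤ B) :
    Continuous (supportFun C) := by
  refine LipschitzWith.continuous (K := B.toNNReal) (LipschitzWith.of_le_add_mul _ fun x y => ?_)
  have h1 := supportFun_add_le hC hB y (x - y)
  have h2 := supportFun_le_mul_norm hC hB (x - y)
  rw [add_sub_cancel] at h1
  have h3 : B ≤ (B.toNNReal : ℝ) := Real.le_coe_toNNReal B
  rw [dist_eq_norm]
  nlinarith [norm_nonneg (x - y)]

theorem supportFun_smul {C : Set V} (hC : C.Nonempty) {B : ℝ} (hB : ∀ q ∈ C, ‖q‖ ≤ B) {s : ℝ}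
    (hs : 0 < s) (v : V) : supportFun C (s • v) ≤ s * supportFun C v := by
  refine supportFun_le hC fun q hq => ?_
  rw [real_inner_smul_right]
  exact mul_le_mul_of_nonneg_left (inner_le_supportFun hB hq v) hs.le

variable [FiniteDimensional ℝ V]

theorem mem_of_inner_le_supportFun {C : Set V} (hC : C.Nonempty) (hconv : Convex ℝ C)
    (hclosed : IsClosed C) {p : V} (h : ∀ v, inner ℝ p v ≤ supportFun C v) : p ∈ C := by
  by_contra hp
  obtain ⟨l, u, hu, hpu⟩ := geometric_hahn_banach_closed_point hconv hclosed hp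
  have hl : ∀ q, l q = inner ℝ q ((InnerProductSpace.toDual ℝ V).symm l) := fun q => by
    rw [real_inner_comm, InnerProductSpace.toDual_symm_apply]
  have h1 := h ((InnerProductSpace.toDual ℝ V).symm l)
  rw [← hl] at h1
  have h2 : supportFun C ((InnerProductSpace.toDual ℝ V).symm l) ≤ u :=
    supportFun_le hC fun q hq => by rw [← hl]; exact (hu q hq).le
  linarith

/-- An increment bound by a positively homogeneous function bounds the gradient. -/
theorem inner_gradient_le {g : V → ℝ} {x p v : V} {m : ℝ} (hg : HasGradientAt g p x)
    (h : ∀ s : ℝ, 0 < s → g (x + s • v) - g x ≤ s * m) : inner ℝ p v ≤ m := by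
  have h1 := (hasGradientAt_iff_hasFDerivAt.1 hg).hasLineDerivAt v
  have h2 : HasDerivAt (fun s : ℝ => g (x + s • v)) (inner ℝ p v) 0 := h1
  have h3 := h2.tendsto_slope_zero_right
  refine le_of_tendsto h3 ?_
  filter_upwards [self_mem_nhdsWithin] with s hs
  have hs' : 0 < s := hs
  have := h s hs'
  simp only [zero_add, zero_smul, add_zero, smul_eq_mul]
  rw [inv_mul_le_iff₀ hs']
  exact this

/-- A nonnegative `C¹` bump function supported in an arbitrarily small ball whose gradients lie in
a given convex body around the origin and fill it up to a given error. -/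
theorem exists_bump_gradient_dense {C : Set V} (hconv : Convex ℝ C) (hclosed : IsClosed C)
    {B r : ℝ} (hB : ∀ q ∈ C, ‖q‖ ≤ B) (hB0 : 0 < B) (hr : 0 < r)
    (hrC : Metric.closedBall 0 r ⊆ C) {ρ δ : ℝ} (hρ : 0 < ρ) (hδ : 0 < δ) :
    ∃ β : V → ℝ, ContDiff ℝ 1 β ∧ (∀ x, 0 ≤ β x) ∧ (∀ x, ρ < ‖x‖ → β x = 0) ∧
      (∀ x y, β x - β y ≤ B * ‖x - y‖) ∧ (∀ x, gradient β x ∈ C) ∧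
      ∀ q ∈ C, ∃ x, ‖x‖ ≤ ρ ∧ ‖gradient β x - q‖ ≤ δ := by
  have h0 : (0 : V) ∈ C := hrC (by simp [hr.le])
  have hne : C.Nonempty := ⟨0, h0⟩
  set σ := supportFun C with hσ
  have hσc : Continuous σ := continuous_supportFun hne hB
  have hσr : ∀ v, r * ‖v‖ ≤ σ v := mul_norm_le_supportFun hB hr hrC
  have hσB : ∀ v, σ v ≤ B * ‖v‖ := supportFun_le_mul_norm hne hB
  have hσ0 : ∀ v, 0 ≤ σ v := fun v => le_trans (by positivity) (hσr v)
  have hσadd : ∀ v w, σ (v + w) ≤ σ v + σ w := supportFun_add_le hne hB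
  set h : ℝ := r * ρ / 2 with hh
  have hhpos : 0 < h := by positivity
  -- The gradient attained will be `(1 - d) • q`, at distance at most `d * B ≤ δ` from `q`; the
  -- factor `1 - d` leaves room for the mollification error.
  set d : ℝ := δ / (δ + B) with hd
  have hd0 : 0 < d := by positivity
  have hd1 : d < 1 := by rw [hd, div_lt_one (by positivity)]; linarith
  have hdB : d * B ≤ δ := by
    rw [hd, div_mul_eq_mul_div, div_le_iff₀ (by positivity)]; nlinarith
  obtain ⟨η, hη, hηρ, hηh⟩ : ∃ η : ℝ, 0 < η ∧ η ≤ ρ / 2 ∧ 2 * B * η < d * h := by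
    refine ⟨min (ρ / 2) (d * h / (4 * B)), by positivity, min_le_left _ _, ?_⟩
    have h1 : min (ρ / 2) (d * h / (4 * B)) ≤ d * h / (4 * B) := min_le_right _ _
    have h2 : 2 * B * (d * h / (4 * B)) = d * h / 2 := by field_simp; ring
    have h3 : 0 < d * h := by positivity
    nlinarith
  -- A truncated cone of height `h`. Subadditivity of `σ` bounds its increments along `v` by `σ v`,
  -- a bound that survives averaging and forces gradients into `C`.
  set b : V → ℝ := fun x => max 0 (h - σ (-x)) with hb
  have hbc : Continuous b := continuous_const.max (continuous_const.sub (hσc.comp continuous_neg))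
  have hbσ : ∀ x v, b (x + v) - b x ≤ σ v := by
    intro x v
    have h1 : σ (-x) ≤ σ (-(x + v)) + σ v := by
      have := hσadd (-(x + v)) v
      rwa [show -(x + v) + v = -x by abel] at this
    have h2 : b (x + v) ≤ b x + σ v := by
      refine max_le (add_nonneg (le_max_left _ _) (hσ0 v)) ?_
      have : h - σ (-x) ≤ b x := le_max_right _ _
      linarith
    linarith
  have hb0 : ∀ x, 0 ≤ b x := fun x => le_max_left _ _
  obtain ⟨g, hg1, hginc, hgle, hgge⟩ := exists_contDiff_average hbc hη
  have hgσ : ∀ x v, g (x + v) - g x ≤ σ v := fun x v => by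
    refine hginc _ _ _ fun t _ => ?_
    have := hbσ (x - t) v
    rwa [show x - t + v = x + v - t by abel] at this
  have hgd : ∀ x, HasGradientAt g (gradient g x) x := fun x =>
    (hg1.differentiable one_ne_zero x).hasGradientAt
  have hbnear : ∀ x t, ‖t‖ ≤ η → b (x - t) ≤ b x + B * η ∧ b x ≤ b (x - t) + B * η := by
    intro x t ht
    have hBt : B * ‖t‖ ≤ B * η := mul_le_mul_of_nonneg_left ht hB0.le
    constructor
    · have h1 := hbσ x (-t)
      have h2 := hσB (-t)
      rw [norm_neg] at h2
      rw [← sub_eq_add_neg] at h1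
      linarith
    · have h1 := hbσ (x - t) t
      have h2 := hσB t
      rw [sub_add_cancel] at h1
      linarith
  refine ⟨g, hg1, fun x => hgge x 0 fun t _ => hb0 _, ?_, ?_, ?_, ?_⟩
  · intro x hx
    have hz : ∀ t, ‖t‖ ≤ η → b (x - t) = 0 := by
      intro t ht
      have h1 : ‖x‖ ≤ ‖-(x - t)‖ + ‖t‖ := by
        rw [norm_neg]
        simpa using norm_add_le (x - t) t
      have h2 := hσr (-(x - t))
      refine max_eq_left ?_
      have h3 : ρ / 2 ≤ ‖-(x - t)‖ := by linarith
      have h4 : r * (ρ / 2) ≤ r * ‖-(x - t)‖ := mul_le_mul_of_nonneg_left h3 hr.le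
      have h5 : h = r * (ρ / 2) := by rw [hh]; ring
      linarith
    exact le_antisymm (hgle x 0 fun t ht => (hz t ht).le) (hgge x 0 fun t ht => (hz t ht).ge)
  · intro x y
    have := hgσ y (x - y)
    rw [add_sub_cancel] at this
    exact this.trans (hσB _)
  · intro x
    refine mem_of_inner_le_supportFun hne hconv hclosed fun v => ?_
    exact inner_gradient_le (hgd x) fun s hs =>
      (hgσ x (s • v)).trans (supportFun_smul hne hB hs v)
  · intro q hq
    set D : Set V := {x | σ (-x) ≤ h} with hD
    have hDb : ∀ x ∈ D, ‖x‖ ≤ ρ / 2 := by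
      intro x hx
      have h1 := hσr (-x)
      rw [norm_neg] at h1
      have h2 : r * ‖x‖ ≤ r * (ρ / 2) := by
        have h5 : h = r * (ρ / 2) := by rw [hh]; ring
        have : σ (-x) ≤ h := hx
        linarith
      exact le_of_mul_le_mul_left h2 hr
    have hDc : IsCompact D := by
      refine Metric.isCompact_of_isClosed_isBounded
        (isClosed_le (hσc.comp continuous_neg) continuous_const) ?_
      exact Metric.isBounded_closedBall.subset
        (fun x hx => mem_closedBall_zero_iff.2 (hDb x hx) : D ⊆ Metric.closedBall 0 (ρ / 2))
    have hσz : σ 0 = 0 := le_antisymm (by simpa using hσB 0) (hσ0 0)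
    have h0D : (0 : V) ∈ D := by
      change σ (-0) ≤ h
      rw [neg_zero, hσz]
      exact hhpos.le
    set q' : V := (1 - d) • q with hq'
    obtain ⟨x, hxD, hxmax⟩ := hDc.exists_isMaxOn ⟨0, h0D⟩
      (f := fun x => g x - inner ℝ q' x)
      ((hg1.continuous.sub (continuous_const.inner continuous_id)).continuousOn)
    have hx0 : g 0 ≤ g x - inner ℝ q' x := by
      have := hxmax h0D
      simpa using this
    have hg0 : h - B * η ≤ g 0 := by
      refine hgge 0 _ fun t ht => ?_
      have h1 := (hbnear 0 t ht).2
      have h2 : h ≤ b 0 := by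
        have : h - σ (-0) ≤ b 0 := le_max_right _ _
        rwa [neg_zero, hσz, sub_zero] at this
      linarith
    -- On `σ (-x) = h` the tilted function is at most `B * η + (1 - d) * h`, whereas at `0` it is at
    -- least `h - B * η`. Since `2 * B * η < d * h`, the maximum is interior, so the gradient there
    -- is `q'`.
    have hxint : σ (-x) < h := by
      by_contra hcon
      have hxe : σ (-x) = h := le_antisymm hxD (not_lt.1 hcon)
      have hbx : b x = 0 := max_eq_left (by rw [hxe, sub_self])
      have h1 : g x ≤ B * η := hgle x _ fun t ht => by
        have := (hbnear x t ht).1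
        rwa [hbx, zero_add] at this
      have h2 : -inner ℝ q' x ≤ (1 - d) * h := by
        rw [← inner_neg_right, hq', real_inner_smul_left, ← hxe]
        exact mul_le_mul_of_nonneg_left (inner_le_supportFun hB hq (-x)) (by linarith)
      nlinarith
    have hnhds : D ∈ 𝓝 x := by
      filter_upwards [(isOpen_lt (hσc.comp continuous_neg) continuous_const).mem_nhds hxint]
        with y hy using le_of_lt hy
    have hloc : IsLocalMax (fun x => g x - inner ℝ q' x) x := hxmax.isLocalMax hnhds
    have hlin : HasFDerivAt (fun y : V => inner ℝ q' y) (innerSL ℝ q') x :=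
      (innerSL ℝ q').hasFDerivAt
    have hder := (hasGradientAt_iff_hasFDerivAt.1 (hgd x)).sub hlin
    have hzero := hloc.hasFDerivAt_eq_zero hder
    have hgq : gradient g x = q' := by
      refine ext_inner_right ℝ fun v => ?_
      have := DFunLike.congr_fun hzero v
      simpa [sub_eq_zero] using this
    refine ⟨x, (hDb x hxD).trans (by linarith), ?_⟩
    rw [hgq, hq', sub_smul, one_smul, sub_sub_cancel_left, norm_neg, norm_smul,
      Real.norm_of_nonneg hd0.le]
    exact (mul_le_mul_of_nonneg_left (hB q hq) hd0.le).trans hdB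

end SupportFunction

/-! ### Local minorants and limits of gradients. -/

section GradientCluster

variable {V : Type*} [NormedAddCommGroup V] [InnerProductSpace ℝ V]

/-- There is a locally defined `C¹` function below `f` which touches `f` at `x`. -/
def HasC1MinorantAt (f : V → ℝ) (x : V) : Prop :=
  ∃ ψ : V → ℝ, ContDiffAt ℝ 1 ψ x ∧ ψ ≤ᶠ[𝓝 x] f ∧ ψ x = f x

theorem ContDiffAt.hasC1MinorantAt {f : V → ℝ} {x : V} (hf : ContDiffAt ℝ 1 f x) :
    HasC1MinorantAt f x :=
  ⟨f, hf, EventuallyLE.rfl, rfl⟩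

theorem HasC1MinorantAt.congr {f g : V → ℝ} {x : V} (hf : HasC1MinorantAt f x)
    (h : g =ᶠ[𝓝 x] f) : HasC1MinorantAt g x := by
  obtain ⟨ψ, h1, h2, h3⟩ := hf
  exact ⟨ψ, h1, h2.trans_eq h.symm, h3.trans h.self_of_nhds.symm⟩

theorem HasC1MinorantAt.rescale {f : V → ℝ} {a : ℝ} (ha : 0 ≤ a) (b : ℝ) (z : V) {x : V}
    (hf : HasC1MinorantAt f (b • (x - z))) :
    HasC1MinorantAt (fun x => a * f (b • (x - z))) x := by
  obtain ⟨ψ, h1, h2, h3⟩ := hf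
  have hc : ContDiff ℝ 1 fun y : V => b • (y - z) := by fun_prop
  refine ⟨fun y => a * ψ (b • (y - z)), ?_, ?_, by simp only [h3]⟩
  · exact contDiffAt_const.mul (h1.comp x hc.contDiffAt)
  · have ht : Tendsto (fun y : V => b • (y - z)) (𝓝 x) (𝓝 (b • (x - z))) :=
      hc.continuous.continuousAt
    filter_upwards [ht.eventually h2] with y hy
    exact mul_le_mul_of_nonneg_left hy ha

/-- Compare `x` with `x - (3 * R) • e`, which lies outside the ball of radius `R`. -/
theorem le_of_lipschitz_of_support {f : V → ℝ} {L R : ℝ} {e : V} (he : ‖e‖ = 1) (hL : 0 ≤ L)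
    (hR : 0 < R) (hf : ∀ x y, f x - f y ≤ L * ‖x - y‖) (hs : ∀ x, R < ‖x‖ → f x = 0) (x : V) :
    f x ≤ 3 * L * R := by
  rcases le_or_gt ‖x‖ R with hx | hx
  · have h1 : R < ‖x - (3 * R) • e‖ := by
      have h2 : ‖(3 * R) • e‖ = 3 * R := by
        rw [norm_smul, he, mul_one, Real.norm_of_nonneg (by positivity)]
      have h3 := norm_sub_norm_le ((3 * R) • e) x
      rw [norm_sub_rev, h2] at h3
      linarith
    have h4 := hf x (x - (3 * R) • e)
    rw [hs _ h1, sub_zero, sub_sub_cancel, norm_smul, he, mul_one,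
      Real.norm_of_nonneg (by positivity)] at h4
    linarith
  · rw [hs x hx]
    positivity

variable [CompleteSpace V]

/-- The set of limits of gradients of `f` at points converging to `x`. -/
def gradientCluster (f : V → ℝ) (x : V) : Set V :=
  {p | ∀ ε : ℝ, 0 < ε → ∃ u, dist u x < ε ∧ dist (gradient f u) p < ε}

theorem gradient_congr {f g : V → ℝ} {x : V} (h : f =ᶠ[𝓝 x] g) : gradient f x = gradient g x := by
  rw [gradient, gradient, h.fderiv_eq]

theorem gradientCluster_congr_gradient {f g : V → ℝ} {x : V}
    (h : gradient f =ᶠ[𝓝 x] gradient g) : gradientCluster f x = gradientCluster g x := by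
  have key : ∀ {f g : V → ℝ}, gradient f =ᶠ[𝓝 x] gradient g →
      gradientCluster f x ⊆ gradientCluster g x := by
    intro f g h p hp ε hε
    obtain ⟨δ, hδ, hball⟩ := Metric.eventually_nhds_iff.1 h
    obtain ⟨u, hu1, hu2⟩ := hp (min ε δ) (lt_min hε hδ)
    refine ⟨u, hu1.trans_le (min_le_left _ _), ?_⟩
    rw [← hball (hu1.trans_le (min_le_right _ _))]
    exact hu2.trans_le (min_le_left _ _)
  exact (key h).antisymm (key h.symm)

theorem gradientCluster_congr {f g : V → ℝ} {x : V} (h : f =ᶠ[𝓝 x] g) :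
    gradientCluster f x = gradientCluster g x :=
  gradientCluster_congr_gradient (h.eventuallyEq_nhds.mono fun _ hu => gradient_congr hu)

theorem HasGradientAt.add {f g : V → ℝ} {p q x : V} (hf : HasGradientAt f p x)
    (hg : HasGradientAt g q x) : HasGradientAt (fun y => f y + g y) (p + q) x := by
  rw [hasGradientAt_iff_hasFDerivAt] at *
  rw [map_add]
  exact HasFDerivAt.add hf hg

theorem gradient_mem_gradientCluster (f : V → ℝ) (x : V) : gradient f x ∈ gradientCluster f x :=
  fun ε hε => ⟨x, by simpa using hε, by simpa using hε⟩

theorem ContDiffAt.continuousAt_gradient {f : V → ℝ} {x : V} (hf : ContDiffAt ℝ 1 f x) :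
    ContinuousAt (gradient f) x := by
  have h1 : ContinuousAt (fderiv ℝ f) x := (hf.fderiv_right (m := 0) (by norm_num)).continuousAt
  exact (InnerProductSpace.toDual ℝ V).symm.continuous.continuousAt.comp h1

theorem gradientCluster_eq_singleton {f : V → ℝ} {x : V} (hf : ContDiffAt ℝ 1 f x) :
    gradientCluster f x = {gradient f x} := by
  refine Set.Subset.antisymm (fun p hp => ?_)
    (Set.singleton_subset_iff.2 (gradient_mem_gradientCluster f x))
  rw [Set.mem_singleton_iff]
  refine eq_of_forall_dist_le fun ε hε => ?_
  obtain ⟨δ, hδ, hball⟩ := Metric.continuousAt_iff.1 hf.continuousAt_gradient (ε / 2) (half_pos hε)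
  obtain ⟨u, hu1, hu2⟩ := hp (min (ε / 2) δ) (lt_min (half_pos hε) hδ)
  have h1 := hball (hu1.trans_le (min_le_right _ _))
  have h2 := hu2.trans_le (min_le_left _ _)
  have h3 := dist_triangle_left p (gradient f x) (gradient f u)
  linarith

theorem gradient_rescale {f : V → ℝ} (hf : Differentiable ℝ f) (a b : ℝ) (z x : V) :
    HasGradientAt (fun x => a * f (b • (x - z))) ((a * b) • gradient f (b • (x - z))) x := by
  have h1 := hasGradientAt_iff_hasFDerivAt.1 (hf (b • (x - z))).hasGradientAt
  have h2 : HasFDerivAt (fun x : V => b • (x - z)) (b • ContinuousLinearMap.id ℝ V) x :=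
    ((hasFDerivAt_id x).sub_const z).const_smul b
  have h3 := (h1.comp x h2).const_mul a
  rw [hasGradientAt_iff_hasFDerivAt]
  refine h3.congr_fderiv ?_
  ext v
  simp [mul_assoc]

theorem gradientCluster_rescale {f : V → ℝ} (hf : Differentiable ℝ f) {a b : ℝ} (ha : 0 < a)
    (hb : 0 < b) (z x : V) :
    gradientCluster (fun x => a * f (b • (x - z))) x =
      (a * b) • gradientCluster f (b • (x - z)) := by
  have hgr : ∀ y, gradient (fun x => a * f (b • (x - z))) y =
    (a * b) • gradient f (b • (y - z)) := fun y => (gradient_rescale hf a b z y).gradient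
  have hab : 0 < a * b := mul_pos ha hb
  ext p
  rw [Set.mem_smul_set_iff_inv_smul_mem₀ hab.ne']
  constructor
  · intro hp ε hε
    obtain ⟨u, hu1, hu2⟩ := hp (min (ε / b) (ε * (a * b)))
      (lt_min (div_pos hε hb) (mul_pos hε hab))
    refine ⟨b • (u - z), ?_, ?_⟩
    · rw [dist_smul₀, dist_sub_right, Real.norm_of_nonneg hb.le, mul_comm, ← lt_div_iff₀ hb]
      exact hu1.trans_le (min_le_left _ _)
    · have h := hu2.trans_le (min_le_right _ _)
      rw [hgr] at h
      rw [← smul_inv_smul₀ hab.ne' p, dist_smul₀, Real.norm_of_nonneg hab.le, mul_comm] at h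
      exact lt_of_mul_lt_mul_right h hab.le
  · intro hp ε hε
    obtain ⟨u, hu1, hu2⟩ := hp (min (ε * b) (ε / (a * b)))
      (lt_min (mul_pos hε hb) (div_pos hε hab))
    have hu : b • (z + b⁻¹ • u - z) = u := by
      rw [add_sub_cancel_left, smul_inv_smul₀ hb.ne']
    refine ⟨z + b⁻¹ • u, ?_, ?_⟩
    · have h := hu1.trans_le (min_le_left _ _)
      rw [← hu, dist_smul₀, dist_sub_right, Real.norm_of_nonneg hb.le, mul_comm] at h
      exact lt_of_mul_lt_mul_right h hb.le
    · rw [hgr, hu, ← smul_inv_smul₀ hab.ne' p, dist_smul₀, Real.norm_of_nonneg hab.le, mul_comm,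
        ← lt_div_iff₀ hab]
      exact hu2.trans_le (min_le_right _ _)

theorem lipschitzWith_of_norm_gradient_le {f : V → ℝ} (hf : Differentiable ℝ f) {L : NNReal}
    (h : ∀ x, ‖gradient f x‖ ≤ L) : LipschitzWith L f := by
  refine lipschitzWith_of_nnnorm_fderiv_le hf fun x => ?_
  have h1 : ‖fderiv ℝ f x‖ = ‖gradient f x‖ := by
    rw [gradient, LinearIsometryEquiv.norm_map]
  exact_mod_cast h1.trans_le (h x)

end GradientCluster

/-! ### Stacks of bumps accumulating on a hyperplane. -/

section Stack

variable {V : Type*} [NormedAddCommGroup V] [InnerProductSpace ℝ V]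

/-- Small nonnegative bumps located in balls whose heights over the hyperplane `e^⊥` are powers
of `1 / 2`. -/
structure IsBumpStack (e : V) (z : ℕ → V) (G : ℕ → V → ℝ) : Prop where
  norm_eq_one : ‖e‖ = 1
  height : ∀ k, inner ℝ e (z k) = (1 / 2 : ℝ) ^ k
  nonneg : ∀ k x, 0 ≤ G k x
  le_pow : ∀ k x, G k x ≤ (1 / 4 : ℝ) ^ k
  eq_zero : ∀ k x, (1 / 2 : ℝ) ^ k / 4 < dist x (z k) → G k x = 0

namespace IsBumpStack

variable {e : V} {z : ℕ → V} {G : ℕ → V → ℝ}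

theorem abs_inner_sub_le (h : IsBumpStack e z G) (x y : V) :
    |inner ℝ e x - inner ℝ e y| ≤ dist x y := by
  rw [← inner_sub_right, dist_eq_norm]
  simpa [h.norm_eq_one] using abs_real_inner_le_norm e (x - y)

theorem height_bounds (h : IsBumpStack e z G) {k : ℕ} {x : V}
    (hx : dist x (z k) ≤ (1 / 2 : ℝ) ^ k / 4) :
    3 / 4 * (1 / 2 : ℝ) ^ k ≤ inner ℝ e x ∧ inner ℝ e x ≤ 5 / 4 * (1 / 2 : ℝ) ^ k := by
  have h1 := abs_le.1 ((h.abs_inner_sub_le x (z k)).trans hx)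
  rw [h.height] at h1
  constructor <;> linarith [h1.1, h1.2]

theorem dist_le_of_ne_zero (h : IsBumpStack e z G) {k : ℕ} {x : V} (hx : G k x ≠ 0) :
    dist x (z k) ≤ (1 / 2 : ℝ) ^ k / 4 := by
  by_contra hc
  exact hx (h.eq_zero k x (not_le.1 hc))

/-- Bump `j` lives at heights between `3/4` and `5/4` times `2⁻ʲ`. The neighbours of `k` thus stop
at `5/8 * 2⁻ᵏ` from below and start at `3/2 * 2⁻ᵏ` from above; for `k = 0` there is no upper
neighbour. -/
theorem eq_zero_of_ne (h : IsBumpStack e z G) {k j : ℕ} {x : V}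
    (h1 : 5 / 8 * (1 / 2 : ℝ) ^ k < inner ℝ e x)
    (h2 : k = 0 ∨ inner ℝ e x < 3 / 2 * (1 / 2 : ℝ) ^ k) (hj : j ≠ k) : G j x = 0 := by
  by_contra hc
  have h3 := h.height_bounds (h.dist_le_of_ne_zero hc)
  rcases lt_or_gt_of_ne hj with hlt | hlt
  · rcases h2 with rfl | h2
    · omega
    · have : (1 / 2 : ℝ) ^ k ≤ (1 / 2 : ℝ) ^ (j + 1) :=
        pow_le_pow_of_le_one (by norm_num) (by norm_num) hlt
      rw [pow_succ] at this
      linarith [h3.1]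
  · have : (1 / 2 : ℝ) ^ j ≤ (1 / 2 : ℝ) ^ (k + 1) :=
      pow_le_pow_of_le_one (by norm_num) (by norm_num) hlt
    rw [pow_succ] at this
    linarith [h3.2]

theorem eventuallyEq (h : IsBumpStack e z G) {k : ℕ} {x : V}
    (h1 : 5 / 8 * (1 / 2 : ℝ) ^ k < inner ℝ e x)
    (h2 : k = 0 ∨ inner ℝ e x < 3 / 2 * (1 / 2 : ℝ) ^ k) :
    (fun y => ∑' j, G j y) =ᶠ[𝓝 x] G k := by
  have hc : Continuous fun y : V => inner ℝ e y := continuous_const.inner continuous_id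
  have e1 := (isOpen_lt continuous_const hc).mem_nhds h1
  have e2 : ∀ᶠ y in 𝓝 x, k = 0 ∨ inner ℝ e y < 3 / 2 * (1 / 2 : ℝ) ^ k := by
    rcases h2 with rfl | h2
    · exact Eventually.of_forall fun _ => Or.inl rfl
    · filter_upwards [(isOpen_lt hc continuous_const).mem_nhds h2] with y hy using Or.inr hy
  filter_upwards [e1, e2] with y hy1 hy2
  exact tsum_eq_single k fun j hj => h.eq_zero_of_ne hy1 hy2 hj

theorem eventuallyEq_of_dist_le (h : IsBumpStack e z G) {k : ℕ} {x : V}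
    (hx : dist x (z k) ≤ (1 / 2 : ℝ) ^ k / 4) : (fun y => ∑' j, G j y) =ᶠ[𝓝 x] G k := by
  have h1 := h.height_bounds hx
  have h2 : (0 : ℝ) < (1 / 2 : ℝ) ^ k := by positivity
  exact h.eventuallyEq (by linarith) (Or.inr (by linarith))

/-- The windows from `5/8 * 2⁻ᵏ` to `3/2 * 2⁻ᵏ` overlap because `(3/2) / (5/8) > 2`, so they cover
all positive heights. -/
theorem exists_eventuallyEq (h : IsBumpStack e z G) {x : V} (hx : 0 < inner ℝ e x) :
    ∃ k, (fun y => ∑' j, G j y) =ᶠ[𝓝 x] G k := by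
  rcases le_or_gt (inner ℝ e x) 1 with hx1 | hx1
  · obtain ⟨n, hn1, hn2⟩ := exists_nat_pow_near_of_lt_one hx hx1
      (by norm_num : (0 : ℝ) < 1 / 2) (by norm_num)
    have hp : (0 : ℝ) < (1 / 2 : ℝ) ^ n := by positivity
    rcases lt_or_ge (5 / 8 * (1 / 2 : ℝ) ^ n) (inner ℝ e x) with h5 | h5
    · exact ⟨n, h.eventuallyEq h5 (Or.inr (by linarith))⟩
    · refine ⟨n + 1, h.eventuallyEq ?_ (Or.inr ?_)⟩ <;> rw [pow_succ] at * <;> linarith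
  · exact ⟨0, h.eventuallyEq (by norm_num; linarith) (Or.inl rfl)⟩

theorem tsum_nonneg (h : IsBumpStack e z G) (x : V) : 0 ≤ ∑' j, G j x :=
  _root_.tsum_nonneg fun k => h.nonneg k x

theorem tsum_eq_zero (h : IsBumpStack e z G) {x : V} (hx : inner ℝ e x ≤ 0) :
    ∑' j, G j x = 0 := by
  have : ∀ j, G j x = 0 := fun j => by
    by_contra hc
    have h3 := (h.height_bounds (h.dist_le_of_ne_zero hc)).1
    have : (0 : ℝ) < (1 / 2 : ℝ) ^ j := by positivity
    linarith
  simp [this]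

theorem pow_le_dist (h : IsBumpStack e z G) {x u : V} (hx : inner ℝ e x ≤ 0) {k : ℕ}
    (hu : dist u (z k) ≤ (1 / 2 : ℝ) ^ k / 4) : (1 / 2 : ℝ) ^ k ≤ 4 / 3 * dist u x := by
  have h1 := (h.height_bounds hu).1
  have h2 := (le_abs_self _).trans (h.abs_inner_sub_le u x)
  linarith

/-- A bump active at `y` forces `2⁻ᵏ ≤ 4/3 * dist y x`, and its size is at most `4⁻ᵏ`, the square of
this. The quadratic bound gives gradient zero on the hyperplane. -/
theorem tsum_le (h : IsBumpStack e z G) {x : V} (hx : inner ℝ e x ≤ 0) (y : V) :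
    ∑' j, G j y ≤ 2 * dist y x ^ 2 := by
  rcases le_or_gt (inner ℝ e y) 0 with hy | hy
  · rw [h.tsum_eq_zero hy]
    positivity
  · obtain ⟨k, hk⟩ := h.exists_eventuallyEq hy
    rw [show ∑' j, G j y = G k y from hk.self_of_nhds]
    by_cases hz : G k y = 0
    · rw [hz]
      positivity
    · have h1 := h.pow_le_dist hx (h.dist_le_of_ne_zero hz)
      have h2 : (1 / 4 : ℝ) ^ k = ((1 / 2 : ℝ) ^ k) ^ 2 := by
        rw [← pow_mul, mul_comm, pow_mul]
        norm_num
      have h3 : ((1 / 2 : ℝ) ^ k) ^ 2 ≤ (4 / 3 * dist y x) ^ 2 :=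
        pow_le_pow_left₀ (by positivity) h1 2
      have h4 := h.le_pow k y
      nlinarith [sq_nonneg (dist y x)]

/-- Used to localize: bumps active near a point of the hyperplane have their centres near that
point. -/
theorem dist_center_le (h : IsBumpStack e z G) {x u : V} (hx : inner ℝ e x ≤ 0) {k : ℕ}
    (hu : dist u (z k) ≤ (1 / 2 : ℝ) ^ k / 4) : dist (z k) x ≤ 2 * dist u x := by
  have h1 := h.pow_le_dist hx hu
  have h2 := dist_triangle_left (z k) x u
  have h3 : 0 ≤ dist u x := dist_nonneg
  linarith

variable [CompleteSpace V]

theorem hasGradientAt_zero (h : IsBumpStack e z G) {x : V} (hx : inner ℝ e x ≤ 0) :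
    HasGradientAt (fun y => ∑' j, G j y) 0 x := by
  rw [hasGradientAt_iff_isLittleO]
  have h1 : (fun y => ∑' j, G j y - ∑' j, G j x - inner ℝ (0 : V) (y - x)) =O[𝓝 x]
      fun y => ‖y - x‖ ^ 2 := by
    refine Asymptotics.IsBigO.of_bound 2 (Eventually.of_forall fun y => ?_)
    rw [h.tsum_eq_zero hx, inner_zero_left, sub_zero, sub_zero,
      Real.norm_of_nonneg (h.tsum_nonneg y), Real.norm_of_nonneg (by positivity), ← dist_eq_norm]
    exact h.tsum_le hx y
  refine h1.trans_isLittleO ?_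
  have h2 := (Asymptotics.isLittleO_norm_pow_id (E' := V) one_lt_two).comp_tendsto
    (show Tendsto (fun y => y - x) (𝓝 x) (𝓝 0) from tendsto_sub_nhds_zero_iff.2 tendsto_id)
  exact h2

theorem differentiable (h : IsBumpStack e z G) (hd : ∀ k, Differentiable ℝ (G k)) :
    Differentiable ℝ fun y => ∑' j, G j y := by
  intro x
  rcases le_or_gt (inner ℝ e x) 0 with hx | hx
  · exact (h.hasGradientAt_zero hx).differentiableAt
  · obtain ⟨k, hk⟩ := h.exists_eventuallyEq hx
    exact (hd k x).congr_of_eventuallyEq hk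

theorem hasGradientAt_zero_or (h : IsBumpStack e z G) (u : V) :
    HasGradientAt (fun y => ∑' j, G j y) 0 u ∨
      ∃ k, dist u (z k) ≤ (1 / 2 : ℝ) ^ k / 4 ∧ (fun y => ∑' j, G j y) =ᶠ[𝓝 u] G k := by
  rcases le_or_gt (inner ℝ e u) 0 with hx | hx
  · exact Or.inl (h.hasGradientAt_zero hx)
  · obtain ⟨k, hk⟩ := h.exists_eventuallyEq hx
    rcases le_or_gt (dist u (z k)) ((1 / 2 : ℝ) ^ k / 4) with hd | hd
    · exact Or.inr ⟨k, hd, hk⟩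
    · left
      have h0 : (fun y => ∑' j, G j y) =ᶠ[𝓝 u] fun _ => (0 : ℝ) := by
        refine hk.trans ?_
        filter_upwards [(isOpen_lt continuous_const (continuous_id.dist continuous_const)).mem_nhds
          hd] with y hy
        exact h.eq_zero k y hy
      exact (hasGradientAt_const u (0 : ℝ)).congr_of_eventuallyEq h0

end IsBumpStack

end Stack

/-! ### Affine plateaus, gradient-filling bumps and the Cantor family. -/

section BuildingBlocks

variable {V : Type*} [NormedAddCommGroup V] [InnerProductSpace ℝ V] [FiniteDimensional ℝ V]

theorem norm_gradient_le_one {g : V → ℝ} (hg : Differentiable ℝ g)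
    (h : ∀ x y, g x - g y ≤ ‖x - y‖) (x : V) : ‖gradient g x‖ ≤ 1 := by
  have h1 : inner ℝ (gradient g x) (gradient g x) ≤ ‖gradient g x‖ :=
    inner_gradient_le (hg x).hasGradientAt fun s hs => by
      have := h (x + s • gradient g x) x
      rwa [add_sub_cancel_left, norm_smul, Real.norm_of_nonneg hs.le] at this
  rw [real_inner_self_eq_norm_sq] at h1
  nlinarith [norm_nonneg (gradient g x)]

theorem exists_bump_gradient_eq {p : V} (hp : ‖p‖ ≤ 1) :
    ∃ A : V → ℝ, ∃ R : ℝ, 4 ≤ R ∧ ContDiff ℝ 1 A ∧ (∀ x, 0 ≤ A x) ∧ (∀ x, R < ‖x‖ → A x = 0) ∧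
      (∀ x, ‖gradient A x‖ ≤ 1) ∧ ∀ x, ‖x‖ ≤ 4 → gradient A x = p := by
  -- Affine with slope `p` for `‖x‖ ≤ 6` (values at most `16`, below `30 - 6`) and zero for `‖x‖ ≥
  -- 30`. Averaging at radius `1` keeps it affine for `‖x‖ ≤ 5`.
  set b : V → ℝ := fun x => max 0 (min (10 + inner ℝ p x) (30 - ‖x‖)) with hb
  have hbc : Continuous b := by fun_prop
  have hinner : ∀ x : V, |inner ℝ p x| ≤ ‖x‖ := fun x =>
    (abs_real_inner_le_norm p x).trans (mul_le_of_le_one_left (norm_nonneg x) hp)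
  have hblip : ∀ x y, b x - b y ≤ ‖x - y‖ := by
    intro x y
    have h1 := (le_abs_self _).trans (hinner (x - y))
    rw [inner_sub_right] at h1
    have h2 := norm_sub_norm_le y x
    rw [norm_sub_rev] at h2
    have h3 : b x ≤ b y + ‖x - y‖ := by
      refine max_le (add_nonneg (le_max_left _ _) (norm_nonneg _)) ?_
      have h4 : min (10 + inner ℝ p y) (30 - ‖y‖) ≤ b y := le_max_right _ _
      rcases min_choice (10 + inner ℝ p y) (30 - ‖y‖) with h5 | h5
      · have := min_le_left (10 + inner ℝ p x) (30 - ‖x‖)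
        linarith
      · have := min_le_right (10 + inner ℝ p x) (30 - ‖x‖)
        linarith
    linarith
  have hbaff : ∀ x, ‖x‖ ≤ 6 → b x = 10 + inner ℝ p x := by
    intro x hx
    have h1 := abs_le.1 (hinner x)
    change max 0 (min (10 + inner ℝ p x) (30 - ‖x‖)) = _
    rw [min_eq_left (by linarith [h1.2]), max_eq_right (by linarith [h1.1])]
  obtain ⟨g, hg, hginc, hgle, hgge⟩ := exists_contDiff_average hbc one_pos
  have hgd : Differentiable ℝ g := hg.differentiable one_ne_zero
  refine ⟨g, 31, by norm_num, hg, fun x => hgge x 0 fun t _ => le_max_left _ _, ?_, ?_, ?_⟩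
  · intro x hx
    have hz : ∀ t, ‖t‖ ≤ 1 → b (x - t) = 0 := by
      intro t ht
      have h1 := norm_sub_norm_le x t
      exact max_eq_left ((min_le_right _ _).trans (by linarith))
    exact le_antisymm (hgle x 0 fun t ht => (hz t ht).le) (hgge x 0 fun t ht => (hz t ht).ge)
  · refine norm_gradient_le_one hgd fun x y => hginc x y _ fun t _ => ?_
    simpa using hblip (x - t) (y - t)
  · have haff : ∀ x y, ‖x‖ ≤ 5 → ‖y‖ ≤ 5 → g x - g y ≤ inner ℝ p (x - y) := by
      intro x y hx hy
      refine hginc x y _ fun t ht => ?_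
      have h1 := norm_sub_le x t
      have h2 := norm_sub_le y t
      rw [hbaff _ (by linarith), hbaff _ (by linarith), inner_sub_right, inner_sub_right,
        inner_sub_right]
      linarith
    intro x hx
    have hev : g =ᶠ[𝓝 x] fun y => inner ℝ p y + g 0 := by
      filter_upwards [(isOpen_lt continuous_norm continuous_const).mem_nhds
        (show ‖x‖ < 5 by linarith)] with y hy
      have hy' : ‖y‖ ≤ 5 := le_of_lt hy
      have h1 := haff y 0 hy' (by simp)
      have h2 := haff 0 y (by simp) hy'
      rw [inner_sub_right, inner_zero_right] at h1 h2
      linarith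
    have hlin : HasGradientAt (fun y : V => inner ℝ p y + g 0) p x := by
      rw [hasGradientAt_iff_hasFDerivAt]
      exact ((InnerProductSpace.toDual ℝ V p).hasFDerivAt).add_const (g 0)
    exact (hlin.congr_of_eventuallyEq hev).gradient

/-- A bump function which, added to the linear form `⟪p, ·⟫`, has gradients close to a prescribed
compact convex set containing `p`. -/
theorem exists_bump_gradient_near {Ψ : Set V} (hconv : Convex ℝ Ψ) (hcomp : IsCompact Ψ) {p : V}
    (hp : ‖p‖ < 1) (hpΨ : p ∈ Ψ) (hΨ : Ψ ⊆ Metric.closedBall 0 1) {ε ρ : ℝ} (hε : 0 < ε)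
    (hε1 : ε ≤ 1) (hρ : 0 < ρ) :
    ∃ β : V → ℝ, ContDiff ℝ 1 β ∧ (∀ x, 0 ≤ β x) ∧ (∀ x, ρ < ‖x‖ → β x = 0) ∧
      (∀ x y, β x - β y ≤ 2 * ‖x - y‖) ∧ (∀ x, ‖p + gradient β x‖ ≤ 1) ∧
      (∀ x, ∃ q ∈ Ψ, ‖p + gradient β x - q‖ ≤ 2 * ε) ∧
      ∀ q ∈ Ψ, ∃ x, ‖x‖ ≤ ρ ∧ ‖p + gradient β x - q‖ ≤ ε := by
  -- `Ψ` may have empty interior. This fattening stays in the unit ball, contains `Ψ`, lies within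
  -- `2 * ε` of it, and contains a ball around `p` because `‖p‖ < 1`.
  set C' : Set V := (1 - ε) • Ψ + ε • Metric.closedBall (0 : V) 1 with hC'
  have hnorm : ∀ q ∈ Ψ, ‖q‖ ≤ 1 := fun q hq => mem_closedBall_zero_iff.1 (hΨ hq)
  have hC'conv : Convex ℝ C' := (hconv.smul _).add ((convex_closedBall 0 1).smul _)
  have hC'comp : IsCompact C' := (hcomp.smul _).add ((isCompact_closedBall 0 1).smul _)
  have hmem : ∀ c, c ∈ C' ↔ ∃ q ∈ Ψ, ∃ v : V, ‖v‖ ≤ 1 ∧ (1 - ε) • q + ε • v = c := by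
    intro c
    simp [hC', Set.mem_add, Set.mem_smul_set]
  have hC'norm : ∀ c ∈ C', ‖c‖ ≤ 1 := by
    intro c hc
    obtain ⟨q, hq, v, hv, rfl⟩ := (hmem c).1 hc
    refine (norm_add_le _ _).trans ?_
    rw [norm_smul, norm_smul, Real.norm_of_nonneg hε.le, Real.norm_of_nonneg (by linarith)]
    nlinarith [hnorm q hq]
  have hΨC' : Ψ ⊆ C' := fun q hq => (hmem q).2 ⟨q, hq, q, hnorm q hq, by
    rw [← add_smul, sub_add_cancel, one_smul]⟩
  set C : Set V := (fun v => p + v) ⁻¹' C' with hC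
  have hrC : Metric.closedBall 0 (ε * (1 - ‖p‖)) ⊆ C := by
    intro v hv
    rw [mem_closedBall_zero_iff] at hv
    refine (hmem _).2 ⟨p, hpΨ, p + ε⁻¹ • v, ?_, ?_⟩
    · refine (norm_add_le _ _).trans ?_
      rw [norm_smul, norm_inv, Real.norm_of_nonneg hε.le]
      have : ε⁻¹ * ‖v‖ ≤ 1 - ‖p‖ := by rwa [inv_mul_le_iff₀ hε]
      linarith
    · rw [smul_add, smul_inv_smul₀ hε.ne', ← add_assoc, ← add_smul, sub_add_cancel, one_smul]
  obtain ⟨β, h1, h2, h3, h4, h5, h6⟩ := exists_bump_gradient_dense (C := C)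
    (hC'conv.translate_preimage_right p) (hC'comp.isClosed.preimage (by fun_prop))
    (B := 2) (fun v hv => by
      have h := hC'norm _ hv
      have := norm_sub_le (p + v) p
      rw [add_sub_cancel_left] at this
      linarith) two_pos (mul_pos hε (sub_pos.2 hp)) hrC hρ hε
  refine ⟨β, h1, h2, h3, h4, fun x => hC'norm _ (h5 x), fun x => ?_, fun q hq => ?_⟩
  · obtain ⟨q, hq, v, hv, hqv⟩ := (hmem _).1 (h5 x)
    refine ⟨q, hq, ?_⟩
    have hqv' : (1 - ε) • q + ε • v = p + gradient β x := hqv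
    rw [← hqv', show (1 - ε) • q + ε • v - q = ε • (v - q) by module, norm_smul,
      Real.norm_of_nonneg hε.le]
    have := norm_sub_le v q
    nlinarith [hnorm q hq]
  · obtain ⟨x, hx1, hx2⟩ := h6 (q - p) (by
      change p + (q - p) ∈ C'
      rw [add_sub_cancel]
      exact hΨC' hq)
    refine ⟨x, hx1, ?_⟩
    rwa [← sub_add, add_comm, ← add_sub_assoc] at hx2

open TopologicalSpace in
/-- A continuous family of compact convex sets over the Cantor set which contains every compact
convex subset of the unit ball through `p`. -/
theorem exists_cantor_family {p : V} (hp : ‖p‖ ≤ 1) :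
    ∃ Ψ : cantorSet → Set V, (∀ a, Convex ℝ (Ψ a) ∧ IsCompact (Ψ a) ∧ p ∈ Ψ a ∧
        Ψ a ⊆ Metric.closedBall 0 1) ∧
      (∀ a, ∀ ε > 0, ∃ δ > 0, ∀ b, dist b a < δ →
        (∀ q ∈ Ψ b, ∃ q' ∈ Ψ a, dist q q' ≤ ε) ∧ ∀ q ∈ Ψ a, ∃ q' ∈ Ψ b, dist q q' ≤ ε) ∧
      ∀ K : Set V, IsCompact K → Convex ℝ K → p ∈ K → K ⊆ Metric.closedBall 0 1 →
        ∃ a, Ψ a = K := by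
  let X := Metric.closedBall (0 : V) 1
  have hXc : CompactSpace X := isCompact_iff_compactSpace.1 (isCompact_closedBall 0 1)
  have hXn : Nonempty X := ⟨⟨p, mem_closedBall_zero_iff.2 hp⟩⟩
  -- Hausdorff–Alexandroff: the compact metric space of nonempty compact subsets of the ball is a
  -- continuous image of the Cantor space.
  obtain ⟨Φ₀, hΦ₀c, hΦ₀s⟩ :=
    exists_nat_bool_continuous_surjective_of_compact (NonemptyCompacts X)
  let Φ : cantorSet → NonemptyCompacts X := Φ₀ ∘ cantorSetHomeomorphNatToBool
  have hΦc : Continuous Φ := hΦ₀c.comp cantorSetHomeomorphNatToBool.continuous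
  have hΦs : Function.Surjective Φ := hΦ₀s.comp cantorSetHomeomorphNatToBool.surjective
  let T : cantorSet → Set V := fun a => insert p ((↑) '' (Φ a : Set X))
  have hTX : ∀ a, T a ⊆ Metric.closedBall 0 1 := by
    intro a
    refine Set.insert_subset (mem_closedBall_zero_iff.2 hp) ?_
    rintro _ ⟨x, -, rfl⟩
    exact x.2
  let Ψ : cantorSet → Set V := fun a => closure (convexHull ℝ (T a))
  have hTΨ : ∀ a, T a ⊆ Ψ a := fun a => (subset_convexHull ℝ _).trans subset_closure
  have hΨmin : ∀ a (K : Set V), T a ⊆ K → Convex ℝ K → IsClosed K → Ψ a ⊆ K :=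
    fun a K h hc hcl => closure_minimal (convexHull_min h hc) hcl
  have hΨX : ∀ a, Ψ a ⊆ Metric.closedBall 0 1 := fun a =>
    hΨmin a _ (hTX a) (convex_closedBall 0 1) Metric.isClosed_closedBall
  have hΨcv : ∀ a, Convex ℝ (Ψ a) := fun a => (convex_convexHull ℝ _).closure
  have hΨcp : ∀ a, IsCompact (Ψ a) := fun a =>
    (isCompact_closedBall 0 1).of_isClosed_subset isClosed_closure (hΨX a)
  -- Adding `p` and taking closed convex hulls does not increase Hausdorff distance, since a closed
  -- thickening of a convex set is closed and convex.
  have hhalf : ∀ a b ε, 0 < ε → dist (Φ b) (Φ a) < ε → ∀ q ∈ Ψ b, ∃ q' ∈ Ψ a, dist q q' ≤ ε := by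
    intro a b ε hε hab
    have hsub : Ψ b ⊆ Metric.cthickening ε (Ψ a) := by
      refine hΨmin b _ ?_ ((hΨcv a).cthickening ε) Metric.isClosed_cthickening
      refine Set.insert_subset
        (Metric.self_subset_cthickening _ (hTΨ a (Set.mem_insert _ _))) ?_
      rintro _ ⟨x, hx, rfl⟩
      have hfin : Metric.hausdorffEDist (Φ b : Set X) (Φ a : Set X) ≠ ⊤ :=
        Metric.hausdorffEDist_ne_top_of_nonempty_of_bounded (Φ b).nonempty (Φ a).nonempty
          (Φ b).isCompact.isBounded (Φ a).isCompact.isBounded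
      obtain ⟨y, hy, hxy⟩ := Metric.exists_dist_lt_of_hausdorffDist_lt hx
        (by rwa [Metric.NonemptyCompacts.dist_eq] at hab) hfin
      exact Metric.mem_cthickening_of_dist_le (x : V) (y : V) ε _
        (hTΨ a (Set.mem_insert_of_mem _ ⟨y, hy, rfl⟩)) hxy.le
    intro q hq
    have := hsub hq
    rw [(hΨcp a).cthickening_eq_biUnion_closedBall hε.le] at this
    simpa using this
  refine ⟨Ψ, fun a => ⟨hΨcv a, hΨcp a, hTΨ a (Set.mem_insert _ _), hΨX a⟩, ?_, ?_⟩
  · intro a ε hε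
    obtain ⟨δ, hδ, h⟩ := Metric.continuous_iff.1 hΦc a ε hε
    exact ⟨δ, hδ, fun b hb => ⟨hhalf a b ε hε (h b hb), hhalf b a ε hε (by
      rw [dist_comm]
      exact h b hb)⟩⟩
  · intro K hK hKc hpK hKX
    let K₀ : Set X := {x | (x : V) ∈ K}
    have hKX' : (↑) '' K₀ = K :=
      (Subtype.image_preimage_coe X K).trans (Set.inter_eq_right.2 hKX)
    have hK₀ : K₀.Nonempty := ⟨⟨p, mem_closedBall_zero_iff.2 hp⟩, hpK⟩
    let K' : NonemptyCompacts X :=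
      ⟨⟨K₀, (hK.isClosed.preimage continuous_subtype_val).isCompact⟩, hK₀⟩
    obtain ⟨a, ha⟩ := hΦs K'
    have hT : T a = K := by
      change insert p ((↑) '' (Φ a : Set X)) = K
      rw [ha]
      change insert p ((↑) '' K₀) = K
      rw [hKX', Set.insert_eq_of_mem hpK]
    refine ⟨a, ?_⟩
    change closure (convexHull ℝ (T a)) = K
    rw [hT, hKc.convexHull_eq, hK.isClosed.closure_eq]

end BuildingBlocks

/-! ### Realizing all compact convex sets through one point `p`. -/

section Piece

variable {V : Type*} [NormedAddCommGroup V] [InnerProductSpace ℝ V] [FiniteDimensional ℝ V]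

/-- A sequence all of whose tails are dense. -/
theorem exists_seq_frequently_dist_lt (X : Type*) [PseudoMetricSpace X]
    [TopologicalSpace.SeparableSpace X] [Nonempty X] :
    ∃ d : ℕ → X, ∀ (a : X) (ε : ℝ) (n : ℕ), 0 < ε → ∃ k, n ≤ k ∧ dist (d k) a < ε := by
  -- Through the pairing function, each point of the dense sequence recurs infinitely often.
  refine ⟨fun k => TopologicalSpace.denseSeq X k.unpair.1, fun a ε n hε => ?_⟩
  obtain ⟨i, hi⟩ := (TopologicalSpace.denseRange_denseSeq X).exists_dist_lt a hε
  refine ⟨Nat.pair i n, Nat.right_le_pair i n, ?_⟩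
  change dist (TopologicalSpace.denseSeq X (Nat.unpair (Nat.pair i n)).1) a < ε
  rwa [Nat.unpair_pair, dist_comm]

/-- A compactly supported differentiable function with gradients in the unit ball whose gradient
limits at suitable points are the given compact convex subsets of the unit ball through `p`. -/
theorem exists_realizing_function {p e₁ e₂ : V} (hp : ‖p‖ < 1) (h₁ : ‖e₁‖ = 1) (h₂ : ‖e₂‖ = 1)
    (h₁₂ : inner ℝ e₂ e₁ = 0) :
    ∃ F : V → ℝ, ∃ R : ℝ, 0 < R ∧ Differentiable ℝ F ∧ (∀ x, 0 ≤ F x) ∧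
      (∀ x, R < ‖x‖ → F x = 0) ∧ (∀ x, ‖gradient F x‖ ≤ 1) ∧ (∀ x, HasC1MinorantAt F x) ∧
      (∀ x, Convex ℝ (gradientCluster F x)) ∧ gradient F 0 = p ∧
      ∀ K : Set V, IsCompact K → Convex ℝ K → p ∈ K → K ⊆ Metric.closedBall 0 1 →
        ∃ x, ‖x‖ ≤ R ∧ gradientCluster F x = K := by
  obtain ⟨A, R, hR, hA, hA0, hAR, hA1, hAp⟩ := exists_bump_gradient_eq hp.le
  obtain ⟨Ψ, hΨ, hΨc, hΨs⟩ := exists_cantor_family hp.le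
  have : Nonempty cantorSet := ⟨⟨0, zero_mem_cantorSet⟩⟩
  obtain ⟨d, hd⟩ := exists_seq_frequently_dist_lt cantorSet
  choose β hβ hβ0 hβs hβ2 hβ1 hβΨ hβd using fun k : ℕ =>
    exists_bump_gradient_near (hΨ (d k)).1 (hΨ (d k)).2.1 hp (hΨ (d k)).2.2.1 (hΨ (d k)).2.2.2
      -- With Lipschitz constant `2`, the height bound `3 * 2 * ρ` is exactly `(1 / 4) ^ k`.
      (ε := (1 / 2) ^ k) (ρ := (1 / 4) ^ k / 6) (by positivity)
      (pow_le_one₀ (by norm_num) (by norm_num)) (by positivity)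
  set z : ℕ → V := fun k => (d k : ℝ) • e₁ + (1 / 2 : ℝ) ^ k • e₂ with hz
  set G : ℕ → V → ℝ := fun k x => β k (x - z k) with hG
  have hpow : ∀ k : ℕ, (1 / 4 : ℝ) ^ k / 6 ≤ (1 / 2 : ℝ) ^ k / 4 := fun k => by
    have h1 : (1 / 4 : ℝ) ^ k ≤ (1 / 2 : ℝ) ^ k :=
      pow_le_pow_left₀ (by norm_num) (by norm_num) k
    have h2 : (0 : ℝ) < (1 / 2 : ℝ) ^ k := by positivity
    linarith
  have hstack : IsBumpStack e₂ z G := by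
    refine ⟨h₂, fun k => ?_, fun k x => hβ0 k _, fun k x => ?_, fun k x hx => ?_⟩
    · simp [hz, inner_add_right, real_inner_smul_right, h₁₂, h₂]
    · refine (le_of_lipschitz_of_support h₁ two_pos.le (by positivity) (hβ2 k) (hβs k) _).trans ?_
      exact le_of_eq (by ring)
    · refine hβs k _ ((hpow k).trans_lt ?_)
      rwa [← dist_eq_norm]
  have hGd : ∀ k, Differentiable ℝ (G k) := fun k =>
    ((hβ k).differentiable one_ne_zero).comp (by fun_prop)
  have hGc : ∀ k, ContDiff ℝ 1 (G k) := fun k => (hβ k).comp (by fun_prop)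
  have hGgrad : ∀ k x, HasGradientAt (G k) (gradient (β k) (x - z k)) x := fun k x => by
    simpa using gradient_rescale ((hβ k).differentiable one_ne_zero) 1 1 (z k) x
  set S : V → ℝ := fun x => ∑' k, G k x with hS
  have hSd : Differentiable ℝ S := hstack.differentiable hGd
  have hAd : Differentiable ℝ A := hA.differentiable one_ne_zero
  set F : V → ℝ := fun x => A x + S x with hF
  have hFd : Differentiable ℝ F := hAd.add hSd
  have hd01 : ∀ k, ‖(d k : ℝ)‖ ≤ 1 := fun k => by
    have := cantorSet_subset_unitInterval (d k).2
    rw [Real.norm_eq_abs, abs_le]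
    exact ⟨by linarith [this.1], this.2⟩
  have hpow1 : ∀ k : ℕ, (1 / 2 : ℝ) ^ k ≤ 1 := fun k => pow_le_one₀ (by norm_num) (by norm_num)
  have hzn : ∀ k, ‖z k‖ ≤ 2 := fun k => by
    refine (norm_add_le _ _).trans ?_
    rw [norm_smul, norm_smul, h₁, h₂, Real.norm_of_nonneg (by positivity : (0 : ℝ) ≤ (1 / 2) ^ k)]
    linarith [hd01 k, hpow1 k]
  have hun : ∀ k u, dist u (z k) ≤ (1 / 2 : ℝ) ^ k / 4 → ‖u‖ ≤ 3 := fun k u hu => by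
    have h3 := norm_le_norm_add_norm_sub' u (z k)
    rw [← dist_eq_norm] at h3
    linarith [hzn k, hpow1 k]
  have hgradF : ∀ u k, dist u (z k) ≤ (1 / 2 : ℝ) ^ k / 4 →
      gradient F u = p + gradient (β k) (u - z k) := by
    intro u k hu
    have h3 := (hAd u).hasGradientAt
    rw [hAp u ((hun k u hu).trans (by norm_num))] at h3
    exact (h3.add ((hGgrad k u).congr_of_eventuallyEq (hstack.eventuallyEq_of_dist_le hu))).gradient
  have hgrad : ∀ u, gradient F u = gradient A u ∨ ∃ k, dist u (z k) ≤ (1 / 2 : ℝ) ^ k / 4 := by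
    intro u
    rcases hstack.hasGradientAt_zero_or u with h | ⟨k, hk, -⟩
    · left
      simpa using ((hAd u).hasGradientAt.add h).gradient
    · exact Or.inr ⟨k, hk⟩
  have hsmooth : ∀ x, 0 < inner ℝ e₂ x → ContDiffAt ℝ 1 F x := by
    intro x hx
    obtain ⟨k, hk⟩ := hstack.exists_eventuallyEq hx
    exact hA.contDiffAt.add ((hGc k).contDiffAt.congr_of_eventuallyEq hk)
  have hzd : ∀ k, dist (z k) ((d k : ℝ) • e₁) = (1 / 2 : ℝ) ^ k := fun k => by
    rw [dist_eq_norm, hz, add_sub_cancel_left, norm_smul, h₂, mul_one,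
      Real.norm_of_nonneg (by positivity)]
  have hdist : ∀ a b : cantorSet, dist ((a : ℝ) • e₁) ((b : ℝ) • e₁) = dist a b := fun a b => by
    rw [dist_eq_norm, ← sub_smul, norm_smul, h₁, mul_one]
    rfl
  have hrange : IsClosed (Set.range fun a : cantorSet => (a : ℝ) • e₁) := by
    have : CompactSpace cantorSet := isCompact_iff_compactSpace.1 isCompact_cantorSet
    exact (isCompact_range (by fun_prop)).isClosed
  -- A bump active near `x` would bring its foot `(d k : ℝ) • e₁` close to `x`, which the closed
  -- Cantor set excludes.
  have hoff : ∀ x, inner ℝ e₂ x ≤ 0 → x ∉ Set.range (fun a : cantorSet => (a : ℝ) • e₁) →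
      gradientCluster F x = {gradient A x} := by
    intro x hx hxr
    rw [← gradientCluster_eq_singleton hA.contDiffAt]
    obtain ⟨δ, hδ, hball⟩ := Metric.isOpen_iff.1 hrange.isOpen_compl x hxr
    refine gradientCluster_congr_gradient ?_
    filter_upwards [Metric.ball_mem_nhds x (by positivity : 0 < δ / 4)] with u hu
    rw [Metric.mem_ball] at hu
    refine (hgrad u).resolve_right ?_
    rintro ⟨k, hk⟩
    have hnot : (d k : ℝ) • e₁ ∉ Metric.ball x δ := fun h => hball h ⟨d k, rfl⟩
    refine hnot ?_
    have h3 := hstack.dist_center_le hx hk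
    have h4 := hstack.pow_le_dist hx hk
    have h5 := dist_triangle_left ((d k : ℝ) • e₁) x (z k)
    rw [hzd] at h5
    rw [Metric.mem_ball]
    have h6 : 0 ≤ dist u x := dist_nonneg
    linarith
  have hin : ∀ a : cantorSet, inner ℝ e₂ ((a : ℝ) • e₁) = 0 := fun a => by
    rw [real_inner_smul_right, h₁₂, mul_zero]
  have hon : ∀ a : cantorSet, gradientCluster F ((a : ℝ) • e₁) = Ψ a := by
    intro a
    refine Set.Subset.antisymm (fun q hq => ?_) (fun q hq ε hε => ?_)
    · rw [← (hΨ a).2.1.isClosed.closure_eq, Metric.mem_closure_iff]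
      intro ε hε
      obtain ⟨δ, hδ, hΨδ⟩ := hΨc a (ε / 4) (by positivity)
      obtain ⟨u, hu1, hu2⟩ := hq (min 1 (min (δ / 4) (ε / 16))) (by positivity)
      have hu3 : dist u ((a : ℝ) • e₁) < 1 := hu1.trans_le (min_le_left _ _)
      have hu4 : dist u ((a : ℝ) • e₁) < δ / 4 :=
        hu1.trans_le ((min_le_right _ _).trans (min_le_left _ _))
      have hu5 : dist u ((a : ℝ) • e₁) < ε / 16 :=
        hu1.trans_le ((min_le_right _ _).trans (min_le_right _ _))
      have hu6 : dist (gradient F u) q < ε / 16 :=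
        hu2.trans_le ((min_le_right _ _).trans (min_le_right _ _))
      -- Away from the bumps the gradient is `p`, a member of `Ψ a`. On bump `k` it is within `2 *
      -- 2⁻ᵏ` of `Ψ (d k)`, where both `2⁻ᵏ` and the distance from `d k` to `a` are controlled by
      -- the distance from `u` to `a • e₁`.
      rcases hgrad u with hcase | ⟨k, hk⟩
      · refine ⟨p, (hΨ a).2.2.1, ?_⟩
        have h3 : ‖u‖ ≤ 4 := by
          have h4 := norm_le_norm_add_norm_sub' u ((a : ℝ) • e₁)
          rw [← dist_eq_norm, norm_smul, h₁, mul_one, Real.norm_eq_abs] at h4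
          have h5 := cantorSet_subset_unitInterval a.2
          rw [abs_of_nonneg h5.1] at h4
          linarith [h5.2]
        rw [hcase, hAp u h3, dist_comm] at hu6
        linarith
      · have h3 := hstack.dist_center_le (hin a).le hk
        have h4 := hstack.pow_le_dist (hin a).le hk
        have h5 := dist_triangle_left ((d k : ℝ) • e₁) ((a : ℝ) • e₁) (z k)
        rw [hzd, hdist] at h5
        have h0 : 0 ≤ dist u ((a : ℝ) • e₁) := dist_nonneg
        obtain ⟨q₁, hq₁, hq₁'⟩ := hβΨ k (u - z k)
        obtain ⟨q₂, hq₂, hq₂'⟩ := (hΨδ (d k) (by linarith)).1 q₁ hq₁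
        refine ⟨q₂, hq₂, ?_⟩
        rw [← hgradF u k hk, ← dist_eq_norm] at hq₁'
        have h6 := dist_triangle_left q q₁ (gradient F u)
        have h7 := dist_triangle q q₁ q₂
        linarith
    · obtain ⟨δ, hδ, hΨδ⟩ := hΨc a (ε / 4) (by positivity)
      obtain ⟨n, hn⟩ := exists_pow_lt_of_lt_one (by positivity : 0 < ε / 4)
        (by norm_num : (1 / 2 : ℝ) < 1)
      -- Density of every tail gives a bump that is both low and close to `a`, with gradients nearly
      -- filling `Ψ (d k)`.
      obtain ⟨k, hnk, hk⟩ := hd a (min δ (ε / 4)) n (by positivity)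
      have hk2 : (1 / 2 : ℝ) ^ k < ε / 4 :=
        (pow_le_pow_of_le_one (by norm_num) (by norm_num) hnk).trans_lt hn
      obtain ⟨q₁, hq₁, hq₁'⟩ := (hΨδ (d k) (hk.trans_le (min_le_left _ _))).2 q hq
      obtain ⟨y, hy, hyq⟩ := hβd k q₁ hq₁
      have hu : dist (z k + y) (z k) ≤ (1 / 2 : ℝ) ^ k / 4 := by
        rw [dist_eq_norm, add_sub_cancel_left]
        exact hy.trans (hpow k)
      refine ⟨z k + y, ?_, ?_⟩
      · have h3 := dist_triangle4 (z k + y) (z k) ((d k : ℝ) • e₁) ((a : ℝ) • e₁)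
        rw [hzd, hdist] at h3
        have h4 := hk.trans_le (min_le_right _ _)
        linarith
      · rw [hgradF _ k hu, add_sub_cancel_left]
        rw [← dist_eq_norm] at hyq
        have h3 := dist_triangle (p + gradient (β k) y) q₁ q
        rw [dist_comm q₁ q] at h3
        linarith
  refine ⟨F, R, by linarith, hFd, fun x => add_nonneg (hA0 x) (hstack.tsum_nonneg x), ?_, ?_, ?_,
    ?_, ?_, ?_⟩
  · intro x hx
    have h3 : ∀ k, G k x = 0 := fun k => by
      by_contra hc
      have := hun k x (hstack.dist_le_of_ne_zero hc)
      linarith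
    simp [hF, hS, hAR x hx, h3]
  · intro x
    rcases hgrad x with h | ⟨k, hk⟩
    · rw [h]
      exact hA1 x
    · rw [hgradF x k hk]
      exact hβ1 k _
  · intro x
    rcases le_or_gt (inner ℝ e₂ x) 0 with hx | hx
    · refine ⟨A, hA.contDiffAt, Eventually.of_forall fun y => ?_, ?_⟩
      · exact le_add_of_nonneg_right (hstack.tsum_nonneg y)
      · simp [hF, hS, hstack.tsum_eq_zero hx]
    · exact (hsmooth x hx).hasC1MinorantAt
  · intro x
    rcases le_or_gt (inner ℝ e₂ x) 0 with hx | hx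
    · by_cases hxr : x ∈ Set.range fun a : cantorSet => (a : ℝ) • e₁
      · obtain ⟨a, rfl⟩ := hxr
        rw [hon a]
        exact (hΨ a).1
      · rw [hoff x hx hxr]
        exact convex_singleton _
    · rw [gradientCluster_eq_singleton (hsmooth x hx)]
      exact convex_singleton _
  · have h3 := (hAd 0).hasGradientAt.add (hstack.hasGradientAt_zero (x := 0) (by simp))
    rw [add_zero, hAp 0 (by simp)] at h3
    exact h3.gradient
  · intro K hK hKc hpK hK1
    obtain ⟨a, ha⟩ := hΨs K hK hKc hpK hK1
    refine ⟨_, ?_, (hon a).trans ha⟩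
    have h3 := cantorSet_subset_unitInterval a.2
    rw [norm_smul, h₁, mul_one, Real.norm_of_nonneg h3.1]
    linarith [h3.2]

end Piece

/-! ### One function for all convex bodies in the unit ball. -/

section Universal

variable {V : Type*} [NormedAddCommGroup V] [InnerProductSpace ℝ V] [FiniteDimensional ℝ V]

/-- A compactly supported differentiable function with gradients in the unit ball, whose sets of
gradient limits are convex and include all convex bodies in the unit ball. -/
theorem exists_universal_function {e₁ e₂ : V} (h₁ : ‖e₁‖ = 1) (h₂ : ‖e₂‖ = 1)
    (h₁₂ : inner ℝ e₂ e₁ = 0) :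
    ∃ f : V → ℝ, ∃ R : ℝ, 0 < R ∧ Differentiable ℝ f ∧ (∀ x, 0 ≤ f x) ∧
      (∀ x, R < ‖x‖ → f x = 0) ∧ (∀ x, ‖gradient f x‖ ≤ 1) ∧ (∀ x, HasC1MinorantAt f x) ∧
      (∀ x, Convex ℝ (gradientCluster f x)) ∧
      ∀ K : Set V, IsCompact K → Convex ℝ K → (interior K).Nonempty →
        K ⊆ Metric.closedBall 0 1 → ∃ x, ‖x‖ ≤ R ∧ gradientCluster f x = K := by
  have : Nonempty (Metric.ball (0 : V) 1) := ⟨⟨0, Metric.mem_ball_self one_pos⟩⟩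
  obtain ⟨d, hd⟩ := exists_seq_frequently_dist_lt (Metric.ball (0 : V) 1)
  choose F R hR hFd hF0 hFs hF1 hFm hFc hFp hFK using fun k : ℕ =>
    exists_realizing_function (mem_ball_zero_iff.1 (d k).2) h₁ h₂ h₁₂
  -- `F k` is shrunk to a support of radius `4⁻ᵏ / 6`; scaling values and arguments by the same
  -- factor leaves gradients unchanged.
  set s : ℕ → ℝ := fun k => (1 / 4) ^ k / (6 * R k) with hs
  have hs0 : ∀ k, 0 < s k := fun k => div_pos (by positivity) (mul_pos (by norm_num) (hR k))
  have hsR : ∀ k, s k * R k = (1 / 4) ^ k / 6 := fun k => by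
    have := (hR k).ne'
    simp only [hs]
    field_simp
  set z : ℕ → V := fun k => (1 / 2 : ℝ) ^ k • e₂ with hz
  set G : ℕ → V → ℝ := fun k x => s k * F k ((s k)⁻¹ • (x - z k)) with hG
  have hpow : ∀ k : ℕ, (1 / 4 : ℝ) ^ k / 6 ≤ (1 / 2 : ℝ) ^ k / 4 := fun k => by
    have h3 : (1 / 4 : ℝ) ^ k ≤ (1 / 2 : ℝ) ^ k :=
      pow_le_pow_left₀ (by norm_num) (by norm_num) k
    have h4 : (0 : ℝ) < (1 / 2 : ℝ) ^ k := by positivity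
    linarith
  have hstack : IsBumpStack e₂ z G := by
    refine ⟨h₂, fun k => ?_, fun k x => mul_nonneg (hs0 k).le (hF0 k _), fun k x => ?_,
      fun k x hx => ?_⟩
    · simp [hz, real_inner_smul_right, h₂]
    · have hlip : ∀ x y, F k x - F k y ≤ 1 * ‖x - y‖ := fun x y => by
        have h3 := (lipschitzWith_of_norm_gradient_le (L := 1) (hFd k) (hF1 k)).dist_le_mul x y
        rw [Real.dist_eq, dist_eq_norm] at h3
        exact (le_abs_self _).trans h3
      have h4 := le_of_lipschitz_of_support h₁ one_pos.le (hR k) hlip (hFs k)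
        ((s k)⁻¹ • (x - z k))
      have h5 := mul_le_mul_of_nonneg_left h4 (hs0 k).le
      have h6 : s k * (3 * 1 * R k) = 3 * ((1 / 4) ^ k / 6) := by rw [← hsR]; ring
      have h7 : (0 : ℝ) < (1 / 4) ^ k := by positivity
      change s k * F k ((s k)⁻¹ • (x - z k)) ≤ _
      linarith
    · change s k * F k ((s k)⁻¹ • (x - z k)) = 0
      rw [hFs k, mul_zero]
      rw [norm_smul, norm_inv, Real.norm_of_nonneg (hs0 k).le, lt_inv_mul_iff₀ (hs0 k), hsR,
        ← dist_eq_norm]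
      exact (hpow k).trans_lt hx
  have hGgrad : ∀ k x, HasGradientAt (G k) (gradient (F k) ((s k)⁻¹ • (x - z k))) x :=
    fun k x => by
      have h3 := gradient_rescale (hFd k) (s k) (s k)⁻¹ (z k) x
      rwa [mul_inv_cancel₀ (hs0 k).ne', one_smul] at h3
  have hGcl : ∀ k x, gradientCluster (G k) x =
      gradientCluster (F k) ((s k)⁻¹ • (x - z k)) := fun k x => by
    have h3 := gradientCluster_rescale (hFd k) (hs0 k) (inv_pos.2 (hs0 k)) (z k) x
    rwa [mul_inv_cancel₀ (hs0 k).ne', one_smul] at h3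
  have hGd : ∀ k, Differentiable ℝ (G k) := fun k x => (hGgrad k x).differentiableAt
  set f : V → ℝ := fun x => ∑' k, G k x with hf
  have hfd : Differentiable ℝ f := hstack.differentiable hGd
  have hpow1 : ∀ k : ℕ, (1 / 2 : ℝ) ^ k ≤ 1 := fun k => pow_le_one₀ (by norm_num) (by norm_num)
  have hzn : ∀ k, ‖z k‖ = (1 / 2 : ℝ) ^ k := fun k => by
    simp only [hz]
    rw [norm_smul, h₂, mul_one, Real.norm_of_nonneg (by positivity)]
  have hgrad1 : ∀ x, ‖gradient f x‖ ≤ 1 := by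
    intro x
    rcases hstack.hasGradientAt_zero_or x with h | ⟨k, -, hk⟩
    · rw [h.gradient, norm_zero]
      exact zero_le_one
    · rw [gradient_congr hk, (hGgrad k x).gradient]
      exact hF1 k _
  -- The gradient at `z k` is `d k`, and the `d k` with `k` large are dense in the unit ball.
  have hzero : gradientCluster f 0 = Metric.closedBall 0 1 := by
    refine Set.Subset.antisymm (fun q hq => ?_) (fun q hq ε hε => ?_)
    · rw [mem_closedBall_zero_iff]
      refine le_of_forall_pos_le_add fun ε hε => ?_
      obtain ⟨u, -, hu⟩ := hq ε hε
      have h3 := norm_le_norm_add_norm_sub (gradient f u) q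
      rw [← dist_eq_norm] at h3
      linarith [hgrad1 u]
    · rw [← closure_ball (0 : V) one_ne_zero, Metric.mem_closure_iff] at hq
      obtain ⟨p, hp, hpq⟩ := hq (ε / 2) (half_pos hε)
      obtain ⟨n, hn⟩ := exists_pow_lt_of_lt_one hε (by norm_num : (1 / 2 : ℝ) < 1)
      obtain ⟨k, hnk, hk⟩ := hd ⟨p, hp⟩ (ε / 2) n (half_pos hε)
      refine ⟨z k, ?_, ?_⟩
      · rw [dist_zero_right, hzn]
        exact (pow_le_pow_of_le_one (by norm_num) (by norm_num) hnk).trans_lt hn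
      · have h3 : f =ᶠ[𝓝 (z k)] G k :=
          hstack.eventuallyEq_of_dist_le (by rw [dist_self]; positivity)
        rw [gradient_congr h3, (hGgrad k _).gradient, sub_self, smul_zero, hFp]
        have h4 : dist (d k : V) p < ε / 2 := hk
        have h5 := dist_triangle_right (d k : V) q p
        linarith
  have hoff : ∀ x, inner ℝ e₂ x ≤ 0 → x ≠ 0 → gradientCluster f x = {0} := by
    intro x hx hx0
    have h3 : gradientCluster f x = gradientCluster (fun _ : V => (0 : ℝ)) x := by
      refine gradientCluster_congr_gradient ?_
      filter_upwards [Metric.ball_mem_nhds x (by positivity : 0 < ‖x‖ / 4)] with u hu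
      rw [Metric.mem_ball] at hu
      rw [(hasGradientAt_const u (0 : ℝ)).gradient]
      rcases hstack.hasGradientAt_zero_or u with h | ⟨k, hk, -⟩
      · exact h.gradient
      · have h3 := hstack.dist_center_le hx hk
        have h4 := hstack.pow_le_dist hx hk
        have h5 := norm_le_norm_add_norm_sub (z k) x
        rw [← dist_eq_norm, hzn] at h5
        have h6 : 0 ≤ dist u x := dist_nonneg
        linarith
    rw [h3, gradientCluster_eq_singleton contDiffAt_const,
      (hasGradientAt_const x (0 : ℝ)).gradient]
  refine ⟨f, 2, two_pos, hfd, hstack.tsum_nonneg, ?_, hgrad1, ?_, ?_, ?_⟩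
  · intro x hx
    have h3 : ∀ k, G k x = 0 := fun k => by
      by_contra hc
      have h4 := hstack.dist_le_of_ne_zero hc
      have h5 := norm_le_norm_add_norm_sub' x (z k)
      rw [← dist_eq_norm, hzn] at h5
      linarith [hpow1 k]
    simp [hf, h3]
  · intro x
    rcases le_or_gt (inner ℝ e₂ x) 0 with hx | hx
    · exact ⟨fun _ => 0, contDiffAt_const, Eventually.of_forall hstack.tsum_nonneg,
        (hstack.tsum_eq_zero hx).symm⟩
    · obtain ⟨k, hk⟩ := hstack.exists_eventuallyEq hx
      exact (HasC1MinorantAt.rescale (hs0 k).le _ (z k) (hFm k _)).congr hk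
  · intro x
    rcases le_or_gt (inner ℝ e₂ x) 0 with hx | hx
    · rcases eq_or_ne x 0 with rfl | hx0
      · rw [hzero]
        exact convex_closedBall 0 1
      · rw [hoff x hx hx0]
        exact convex_singleton _
    · obtain ⟨k, hk⟩ := hstack.exists_eventuallyEq hx
      rw [gradientCluster_congr hk, hGcl]
      exact hFc k _
  · intro K hK hKc hKi hK1
    obtain ⟨c, hc⟩ := hKi
    have hcb : c ∈ Metric.ball (0 : V) 1 := by
      have h3 := interior_mono hK1 hc
      rwa [interior_closedBall _ one_ne_zero] at h3
    obtain ⟨ε, hε, hball⟩ := Metric.isOpen_iff.1 isOpen_interior c hc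
    -- The only use of the nonempty interior: some `d k` lies in `K`, so the `k`-th piece realizes
    -- `K`.
    obtain ⟨k, -, hk⟩ := hd ⟨c, hcb⟩ ε 0 hε
    obtain ⟨x, hxR, hx⟩ := hFK k K hK hKc (interior_subset (hball hk)) hK1
    have hsx : ‖s k • x‖ ≤ (1 / 2 : ℝ) ^ k / 4 := by
      rw [norm_smul, Real.norm_of_nonneg (hs0 k).le]
      refine le_trans ?_ (hpow k)
      rw [← hsR]
      exact mul_le_mul_of_nonneg_left hxR (hs0 k).le
    have h3 : f =ᶠ[𝓝 (z k + s k • x)] G k :=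
      hstack.eventuallyEq_of_dist_le (by rwa [dist_eq_norm, add_sub_cancel_left])
    refine ⟨z k + s k • x, ?_, ?_⟩
    · refine (norm_add_le _ _).trans ?_
      rw [hzn]
      linarith [hpow1 k]
    rw [gradientCluster_congr h3, hGcl, add_sub_cancel_left, inv_smul_smul₀ (hs0 k).ne', hx]

end Universal

/-! ### Both subdifferentials in terms of gradient clusters. -/

section Subdifferentials

variable {N : ℕ} {f : EuclideanSpace ℝ (Fin N) → ℝ} {x : EuclideanSpace ℝ (Fin N)}

theorem clarkeSubdiff_eq_convexHull (hf : Differentiable ℝ f) (x : EuclideanSpace ℝ (Fin N)) :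
    clarkeSubdiff f x = convexHull ℝ (gradientCluster f x) := by
  refine congrArg (convexHull ℝ) (Set.ext fun p => ⟨?_, fun hp => ?_⟩)
  · rintro ⟨u, -, hu, hp⟩ ε hε
    obtain ⟨n, hn1, hn2⟩ :=
      ((hu.eventually (Metric.ball_mem_nhds x hε)).and
        (hp.eventually (Metric.ball_mem_nhds p hε))).exists
    exact ⟨u n, hn1, hn2⟩
  · choose u hu1 hu2 using fun n : ℕ => hp (1 / ((n : ℝ) + 1)) Nat.one_div_pos_of_nat
    refine ⟨u, fun n => hf _, ?_, ?_⟩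
    · exact tendsto_iff_dist_tendsto_zero.2 (squeeze_zero (fun _ => dist_nonneg)
        (fun n => (hu1 n).le) tendsto_one_div_add_atTop_nhds_zero_nat)
    · exact tendsto_iff_dist_tendsto_zero.2 (squeeze_zero (fun _ => dist_nonneg)
        (fun n => (hu2 n).le) tendsto_one_div_add_atTop_nhds_zero_nat)

theorem gradient_eq_of_touching {φ : EuclideanSpace ℝ (Fin N) → ℝ} (hf : DifferentiableAt ℝ f x)
    (hφ : DifferentiableAt ℝ φ x) (hle : φ ≤ᶠ[𝓝 x] f) (heq : φ x = f x) :
    gradient φ x = gradient f x := by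
  have hmin : IsLocalMin (fun y => f y - φ y) x := by
    filter_upwards [hle] with y hy
    rw [heq, sub_self]
    exact sub_nonneg.2 hy
  have h := hmin.hasFDerivAt_eq_zero (hf.hasFDerivAt.sub hφ.hasFDerivAt)
  rw [gradient, gradient, sub_eq_zero.1 h]

/-- A local minorant is made global by a cutoff `χ`: as `0 ≤ χ ≤ 1` and `f ≥ 0`, one has `χ * ψ ≤ χ
* f ≤ f` where `ψ ≤ f`, and `0 ≤ f` elsewhere. -/
theorem gradient_mem_frechetSubdiff (hf : Differentiable ℝ f) (h0 : ∀ y, 0 ≤ f y)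
    (hm : HasC1MinorantAt f x) : gradient f x ∈ frechetSubdiff f x := by
  obtain ⟨ψ, hψ, hle, heq⟩ := hm
  obtain ⟨ε, hε, hball⟩ := Metric.eventually_nhds_iff.1
    ((hψ.eventually (by simp)).and hle)
  let χ : ContDiffBump x := ⟨ε / 4, ε / 2, by linarith, by linarith⟩
  have hsmooth : ContDiff ℝ 1 fun y => χ y * ψ y := by
    rw [contDiff_iff_contDiffAt]
    intro y
    rcases lt_or_ge (dist y x) ε with hy | hy
    · exact χ.contDiffAt.mul (hball hy).1
    · refine (contDiffAt_const (c := (0 : ℝ))).congr_of_eventuallyEq ?_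
      filter_upwards [(isOpen_lt continuous_const
        (continuous_id.dist (continuous_const (y := x)))).mem_nhds
        (show ε / 2 < dist y x by linarith)] with w hw
      have hw' : ε / 2 ≤ dist w x := le_of_lt hw
      rw [χ.zero_of_le_dist hw', zero_mul]
  have hφle : ∀ y, χ y * ψ y ≤ f y := by
    intro y
    rcases lt_or_ge (dist y x) ε with hy | hy
    · have h1 := (hball hy).2
      have h2 := mul_le_mul_of_nonneg_left h1 (χ.nonneg (x := y))
      have h3 := mul_le_mul_of_nonneg_right (χ.le_one (x := y)) (h0 y)
      linarith
    · rw [χ.zero_of_le_dist (le_trans (show ε / 2 ≤ ε by linarith) hy), zero_mul]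
      exact h0 y
  have hφx : χ x * ψ x = f x := by
    rw [χ.one_of_mem_closedBall (Metric.mem_closedBall_self χ.rIn_pos.le), one_mul, heq]
  exact ⟨_, hsmooth, hφle, hφx, gradient_eq_of_touching (hf x)
    (hsmooth.differentiable one_ne_zero x) (Eventually.of_forall hφle) hφx⟩

theorem limitingSubdiff_eq_gradientCluster (hf : Differentiable ℝ f) (h0 : ∀ y, 0 ≤ f y)
    (hm : ∀ y, HasC1MinorantAt f y) (x : EuclideanSpace ℝ (Fin N)) :
    limitingSubdiff f x = gradientCluster f x := by
  refine Set.ext fun p => ⟨?_, fun hp => ?_⟩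
  · rintro ⟨u, v, hv, hu, hp⟩ ε hε
    obtain ⟨n, hn1, hn2⟩ :=
      ((hu.eventually (Metric.ball_mem_nhds x hε)).and
        (hp.eventually (Metric.ball_mem_nhds p hε))).exists
    obtain ⟨φ, h1, h2, h3, h4⟩ := hv n
    refine ⟨u n, hn1, ?_⟩
    rw [← gradient_eq_of_touching (hf (u n)) (h1.differentiable one_ne_zero _)
      (Eventually.of_forall h2) h3, h4]
    exact hn2
  · choose u hu1 hu2 using fun n : ℕ => hp (1 / ((n : ℝ) + 1)) Nat.one_div_pos_of_nat
    refine ⟨u, fun n => gradient f (u n),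
      fun n => gradient_mem_frechetSubdiff hf h0 (hm _), ?_, ?_⟩
    · exact tendsto_iff_dist_tendsto_zero.2 (squeeze_zero (fun _ => dist_nonneg)
        (fun n => (hu1 n).le) tendsto_one_div_add_atTop_nhds_zero_nat)
    · exact tendsto_iff_dist_tendsto_zero.2 (squeeze_zero (fun _ => dist_nonneg)
        (fun n => (hu2 n).le) tendsto_one_div_add_atTop_nhds_zero_nat)

theorem subdiff_eq_of_gradientCluster_eq (hf : Differentiable ℝ f) (h0 : ∀ y, 0 ≤ f y)
    (hm : ∀ y, HasC1MinorantAt f y) {K : Set (EuclideanSpace ℝ (Fin N))} (hK : Convex ℝ K)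
    (h : gradientCluster f x = K) : clarkeSubdiff f x = K ∧ limitingSubdiff f x = K := by
  rw [clarkeSubdiff_eq_convexHull hf, limitingSubdiff_eq_gradientCluster hf h0 hm, h,
    hK.convexHull_eq]
  exact ⟨rfl, rfl⟩

end Subdifferentials

/-! ### Assembly of the two statements. -/

theorem mainTheorem2 (N : ℕ) (hN : 2 ≤ N) :
    (∃ f : EuclideanSpace ℝ (Fin N) → ℝ,
      Differentiable ℝ f ∧ LipschitzWith 1 f ∧ HasCompactSupport f ∧
      (∀ x, clarkeSubdiff f x = limitingSubdiff f x) ∧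
      ∀ K : Set (EuclideanSpace ℝ (Fin N)), IsConvexBody K → K ⊆ Metric.closedBall 0 1 →
        ∃ x, clarkeSubdiff f x = K ∧ limitingSubdiff f x = K) ∧
    (∃ (f : ℕ → EuclideanSpace ℝ (Fin N) → ℝ) (g : EuclideanSpace ℝ (Fin N) → ℝ),
      (∀ n, Differentiable ℝ (f n) ∧ LipschitzWith ((n : NNReal) + 1) (f n) ∧
        HasCompactSupport (f n) ∧
        ∀ K : Set (EuclideanSpace ℝ (Fin N)), IsConvexBody K →
          K ⊆ Metric.closedBall 0 ((n : ℝ) + 1) →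
          ∃ x, clarkeSubdiff (f n) x = K ∧ limitingSubdiff (f n) x = K) ∧
      (∀ m n, m ≠ n → Disjoint (tsupport (f m)) (tsupport (f n))) ∧
      (∀ x, HasSum (fun n => f n x) (g x)) ∧
      Differentiable ℝ g ∧ LocallyLipschitz g ∧
      ∀ K : Set (EuclideanSpace ℝ (Fin N)), IsConvexBody K →
        ∃ x, clarkeSubdiff g x = K ∧ limitingSubdiff g x = K) := by
  set e₁ : EuclideanSpace ℝ (Fin N) := EuclideanSpace.single ⟨0, by omega⟩ 1 with he₁
  set e₂ : EuclideanSpace ℝ (Fin N) := EuclideanSpace.single ⟨1, by omega⟩ 1 with he₂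
  have h₁ : ‖e₁‖ = 1 := by simp [he₁]
  have h₂ : ‖e₂‖ = 1 := by simp [he₂]
  have h₁₂ : inner ℝ e₂ e₁ = 0 := by
    simp [he₁, he₂, EuclideanSpace.inner_single_left]
  obtain ⟨f, R, hR, hfd, hf0, hfs, hf1, hfm, hfc, hfK⟩ := exists_universal_function h₁ h₂ h₁₂
  refine ⟨⟨f, hfd, lipschitzWith_of_norm_gradient_le hfd hf1, ?_, fun x => ?_, ?_⟩, ?_⟩
  · refine HasCompactSupport.intro (isCompact_closedBall 0 R) fun x hx => hfs x ?_
    rwa [mem_closedBall_zero_iff, not_le] at hx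
  · obtain ⟨h3, h4⟩ := subdiff_eq_of_gradientCluster_eq hfd hf0 hfm (hfc x) rfl
    rw [h3, h4]
  · rintro K ⟨hK, hKc, hKi⟩ hK1
    obtain ⟨x, -, hx⟩ := hfK K hK hKc hKi hK1
    exact ⟨x, subdiff_eq_of_gradientCluster_eq hfd hf0 hfm hKc hx⟩
  -- Supports lie in balls of radius `R` whose centres are at least `3 * R` apart, so the gaps make
  -- the sum locally a single term.
  set c : ℕ → EuclideanSpace ℝ (Fin N) := fun n => (3 * R * n) • e₁ with hc
  have hcd : ∀ m n, m ≠ n → 3 * R ≤ dist (c m) (c n) := by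
    intro m n hmn
    have h3 : (1 : ℝ) ≤ |(m : ℝ) - n| := by
      have : (1 : ℤ) ≤ |(m : ℤ) - n| := Int.one_le_abs (by omega)
      exact_mod_cast this
    rw [dist_eq_norm, ← sub_smul, norm_smul, h₁, mul_one, ← mul_sub, Real.norm_eq_abs, abs_mul,
      abs_of_pos (by positivity : 0 < 3 * R)]
    exact le_mul_of_one_le_right (by positivity) h3
  have hn0 : ∀ n : ℕ, (0 : ℝ) < (n : ℝ) + 1 := fun n => by positivity
  -- Compressing the argument by `n + 1` multiplies gradients by `n + 1`. The index starts at `0`,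
  -- so `F n` plays the role of the `(n + 1)`-st function; the factor `1` matches the form of
  -- `gradient_rescale`.
  set F : ℕ → EuclideanSpace ℝ (Fin N) → ℝ :=
    fun n x => 1 * f (((n : ℝ) + 1) • (x - c n)) with hF
  have hFgrad : ∀ n x, HasGradientAt (F n)
      (((n : ℝ) + 1) • gradient f (((n : ℝ) + 1) • (x - c n))) x := fun n x => by
    have h3 := gradient_rescale hfd 1 ((n : ℝ) + 1) (c n) x
    rwa [one_mul] at h3
  have hFcl : ∀ n x, gradientCluster (F n) x =
      ((n : ℝ) + 1) • gradientCluster f (((n : ℝ) + 1) • (x - c n)) := fun n x => by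
    have h3 := gradientCluster_rescale hfd one_pos (hn0 n) (c n) x
    rwa [one_mul] at h3
  have hFd : ∀ n, Differentiable ℝ (F n) := fun n x => (hFgrad n x).differentiableAt
  have hF0 : ∀ n x, 0 ≤ F n x := fun n x => mul_nonneg zero_le_one (hf0 _)
  have hFm : ∀ n x, HasC1MinorantAt (F n) x := fun n x =>
    HasC1MinorantAt.rescale zero_le_one _ (c n) (hfm _)
  have hFs : ∀ n x, F n x ≠ 0 → dist x (c n) ≤ R := by
    intro n x hx
    by_contra hcon
    refine hx ?_
    change 1 * f (((n : ℝ) + 1) • (x - c n)) = 0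
    rw [hfs, mul_zero]
    rw [norm_smul, Real.norm_of_nonneg (hn0 n).le, ← dist_eq_norm]
    have h3 : (0 : ℝ) ≤ n := Nat.cast_nonneg n
    nlinarith [not_le.1 hcon]
  have hFL : ∀ n : ℕ, LipschitzWith ((n : NNReal) + 1) (F n) := by
    intro n
    refine lipschitzWith_of_norm_gradient_le (hFd n) fun x => ?_
    rw [(hFgrad n x).gradient, norm_smul, Real.norm_of_nonneg (hn0 n).le]
    push_cast
    exact mul_le_of_le_one_right (hn0 n).le (hf1 _)
  have hFK : ∀ (n : ℕ) (K : Set (EuclideanSpace ℝ (Fin N))), IsConvexBody K →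
      K ⊆ Metric.closedBall 0 ((n : ℝ) + 1) →
      ∃ x, dist x (c n) ≤ R ∧ gradientCluster (F n) x = K := by
    rintro n K ⟨hK, hKc, hKi⟩ hKn
    obtain ⟨x, hxR, hx⟩ := hfK (((n : ℝ) + 1)⁻¹ • K) (hK.smul _) (hKc.smul _)
      (by
        rw [interior_smul₀ (inv_ne_zero (hn0 n).ne')]
        exact hKi.smul_set)
      (by
        rintro _ ⟨q, hq, rfl⟩
        have h3 := mem_closedBall_zero_iff.1 (hKn hq)
        rw [mem_closedBall_zero_iff]
        simp only [norm_smul, norm_inv]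
        rwa [Real.norm_of_nonneg (hn0 n).le, inv_mul_le_iff₀ (hn0 n), mul_one])
    refine ⟨c n + ((n : ℝ) + 1)⁻¹ • x, ?_, ?_⟩
    · rw [dist_eq_norm, add_sub_cancel_left, norm_smul, norm_inv, Real.norm_of_nonneg (hn0 n).le,
        inv_mul_le_iff₀ (hn0 n)]
      have h3 : (0 : ℝ) ≤ n := Nat.cast_nonneg n
      nlinarith
    · rw [hFcl, add_sub_cancel_left, smul_inv_smul₀ (hn0 n).ne', hx, smul_inv_smul₀ (hn0 n).ne']
  set g : EuclideanSpace ℝ (Fin N) → ℝ := fun x => ∑' n, F n x with hg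
  have hnear : ∀ n x y, dist x (c n) ≤ R → dist y x < R / 2 → ∀ m, m ≠ n → F m y = 0 := by
    intro n x y hx hy m hmn
    by_contra hcon
    have h3 := hFs m y hcon
    have h4 := dist_triangle4 (c m) y x (c n)
    rw [dist_comm (c m) y] at h4
    linarith [hcd m n hmn]
  have hsingle : ∀ x, ∃ n, ∀ y, dist y x < R / 4 → ∀ m, m ≠ n → F m y = 0 := by
    intro x
    by_cases hex : ∃ n, ∃ w, dist w x < R / 4 ∧ F n w ≠ 0
    · obtain ⟨n, w, hw, hnw⟩ := hex
      refine ⟨n, fun y hy => hnear n w y (hFs n w hnw) ?_⟩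
      have h3 := dist_triangle_right y w x
      linarith
    · push Not at hex
      exact ⟨0, fun y hy m _ => hex m y hy⟩
  have hgF : ∀ x, ∃ n, g =ᶠ[𝓝 x] F n := by
    intro x
    obtain ⟨n, hn⟩ := hsingle x
    refine ⟨n, ?_⟩
    filter_upwards [Metric.ball_mem_nhds x (by positivity : 0 < R / 4)] with y hy
    exact tsum_eq_single n (hn y hy)
  have hgd : Differentiable ℝ g := fun x => by
    obtain ⟨n, hn⟩ := hgF x
    exact (hFd n x).congr_of_eventuallyEq hn
  have hg0 : ∀ x, 0 ≤ g x := fun x => tsum_nonneg fun n => hF0 n x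
  have hgm : ∀ x, HasC1MinorantAt g x := fun x => by
    obtain ⟨n, hn⟩ := hgF x
    exact (hFm n x).congr hn
  have hFt : ∀ n, tsupport (F n) ⊆ Metric.closedBall (c n) R := fun n =>
    closure_minimal (fun x hx => hFs n x hx) Metric.isClosed_closedBall
  refine ⟨F, g, fun n => ⟨hFd n, hFL n, ?_, fun K hK hKn => ?_⟩, ?_, ?_, hgd, ?_, ?_⟩
  · exact (isCompact_closedBall (c n) R).of_isClosed_subset (isClosed_tsupport _) (hFt n)
  · obtain ⟨x, -, hx⟩ := hFK n K hK hKn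
    exact ⟨x, subdiff_eq_of_gradientCluster_eq (hFd n) (hF0 n) (hFm n) hK.2.1 hx⟩
  · intro m n hmn
    refine (Metric.closedBall_disjoint_closedBall ?_).mono (hFt m) (hFt n)
    linarith [hcd m n hmn]
  · intro x
    obtain ⟨n, hn⟩ := hsingle x
    have h3 := hn x (by rw [dist_self]; positivity)
    rw [hg]
    exact (hasSum_single n h3).summable.hasSum
  · intro x
    obtain ⟨n, hn⟩ := hgF x
    refine ⟨(n : NNReal) + 1, _, hn, fun y hy w hw => ?_⟩
    have hy' : g y = F n y := hy
    have hw' : g w = F n w := hw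
    rw [hy', hw']
    exact hFL n y w
  · intro K hK
    obtain ⟨r, hr⟩ := hK.1.isBounded.subset_closedBall 0
    obtain ⟨n, hn⟩ := exists_nat_ge r
    obtain ⟨x, hxR, hx⟩ := hFK n K hK
      (hr.trans (Metric.closedBall_subset_closedBall (by linarith)))
    have h3 : g =ᶠ[𝓝 x] F n := by
      filter_upwards [Metric.ball_mem_nhds x (by positivity : 0 < R / 2)] with y hy
      exact tsum_eq_single n (hnear n x y hxR hy)
    exact ⟨x, subdiff_eq_of_gradientCluster_eq hgd hg0 hgm hK.2.1
      ((gradientCluster_congr h3).trans hx)⟩
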